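/- Let $N\ge1$, let $\Phi_1,\dots,\Phi_N,\Psi_1,\dots,\Psi_N$ be complex-valued functions on $\mathbb{Z}_{\ge0}$ and let $\beta_1,\dots,\beta_{N-1}\in\mathbb{C}$. For functions $f$ on $\mathbb{Z}_{\ge0}$ put $$D^{(r)}f(k)=f(k)-\beta_r f(k+1),\qquad D^{(r)\dagger}f(k)=f(k)-\beta_r f(k-1)\mathbf 1_{k\ge1},$$ $D^{[a,b)}=D^{(a)}D^{(a+1)}\cdots D^{(b-1)}$ and $D^{[a,b)\dagger}=D^{(a)\dagger}\cdots D^{(b-1)\dagger}$ (the identity if $a=b$), and $T_\beta(x,y)=\mathbf 1_{y=x}-\beta\,\mathbf 1_{y=x-1}$ for $x,y\in\mathbb{Z}_{\ge0}$; $*$ denotes discrete convolution, e.g. $(f*g)(x,y)=\sum_{z\ge0}f(x,z)g(z,y)$. For configurations $X=(\ell_1>\dots>\ell_N\ge0)$ let $$\mathscr W(X)=\det\bigl[D^{[1,j)}\Phi_i(\ell_j)\bigr]_{i,j=1}^N\det\bigl[D^{[j,N)\dagger}\Psi_i(\ell_j)\bigr]_{i,j=1}^N,\qquad \mathscr Z=\sum_X\mathscr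 W(X).$$ Assume that all the multiple series $\Phi_i*T_{\beta_1}*\cdots*T_{\beta_{N-1}}*\Psi_j$, that is, $$\sum_{y_1,\dots,y_N\ge0}\Phi_i(y_1)\,T_{\beta_1}(y_1,y_2)\cdots T_{\beta_{N-1}}(y_{N-1},y_N)\,\Psi_j(y_N),\qquad 1\le i,j\le N,$$ converge absolutely, and that the series $\mathscr Z$ converges and is nonzero. Let $\mathscr M=\mathscr W/\mathscr Z$ be the (complex-valued, total mass $1$) $\vec\beta$-tilted biorthogonal ensemble. Put $G_{ij}=\sum_{k\ge0}\Psi_j(k)\,D^{[1,N)}\Phi_i(k)$ and, for $(x,t),(y,s)\in\mathbb{Z}_{\ge0}\times\{1,\dots,N\}$, $$K(x,t;y,s)=-\mathbf 1_{t>s}\bigl(T_{\beta_s}*\cdots*T_{\beta_{t-1}}\bigr)(y,x)+\sum_{i,j=1}^N (G^{-1})_{ji}\,D^{[1,t)}\Phi_i(x)\,D^{[s,N)\dagger}\Psi_j(y).$$ Let $B_i(a)=\{0,\dots,a-1\}\times\{i\}$ and $C_i(a)=\{a\}\times\{i\}$. **(1) Marginals.** Let $k\ge1$, $1\le i_1<\dots<i_k\le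 N$, and let $a_1>\dots>a_k\ge0$ be integers. Put $F=\bigcup_{p=1}^k\bigl(B_{i_p}(a_p)\cup C_{i_p}(a_p)\bigr)$. Then $$\mathscr M(\ell_{i_1}=a_1,\dots,\ell_{i_k}=a_k)=\bigl[z_1^{N-i_1}\cdots z_k^{N-i_k}\,w_1\cdots w_k\bigr]\det\Bigl(\mathbf 1-\chi_F\sum_{p=1}^k(1-z_p)K\chi_{B_{i_p}(a_p)}-\chi_F\sum_{p=1}^k(1-w_p)K\chi_{C_{i_p}(a_p)}\Bigr),$$ where $[\,\cdot\,]$ is the coefficient of the indicated monomial, $\chi_S$ is the indicator of $S$, and the determinant is that of the square matrix with rows and columns indexed by $F$. The matrix has size $\sum_{p=1}^k(a_p+1)$, and its determinant is a polynomial in the entries of $K$: there is a polynomial with coefficients in $\mathbb{Z}[z_1,\dots,z_k,w_1,\dots,w_k]$, depending only on $N$, $(i_p)$ and $(a_p)$, whose value at the entries of the kernel is the determinant, for every kernel $K$. **(2) Correlation functions.** For every $k\ge1$ and pairwise distinct $a_1,\dots,a_k\in\mathbb{Z}_{\ge0}$, $$\mathscr M(X\text{ contains }a_1,\dots,a_k)=\sum_{1\le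 i_1<\dots<i_k\le N}\mathscr M\bigl(\{\ell_{i_1},\dots,\ell_{i_k}\}=\{a_1,\dots,a_k\}\bigr),$$ and each summand equals the coefficient in (1) for the indices $i_1<\dots<i_k$ and the decreasing rearrangement of $a_1,\dots,a_k$. -/

import Mathlib

open Finset

noncomputable section

namespace TiltedEnsemble

/-! Indexing conventions. The indices `1, …, N` are represented by `Fin N`, so `j : Fin N` stands
for the index (or the level) `j + 1`. The parameters `β₁, …, β_{N-1}` are the values
`β 1, …, β (N - 1)` of `β : ℕ → ℂ`; no other value of `β` enters anything below. -/

/-- The difference operator `(D f)(k) = f(k) - b f(k+1)`. -/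
def diffOp (b : ℂ) (f : ℕ → ℂ) : ℕ → ℂ := fun k => f k - b * f (k + 1)

/-- The conjugate operator `(D† f)(k) = f(k) - b f(k-1) 1_{k ≥ 1}`. -/
def diffOpDagger (b : ℂ) (f : ℕ → ℂ) : ℕ → ℂ :=
  fun k => f k - b * (if 1 ≤ k then f (k - 1) else 0)

/-- `D^{[a,b)} = D^{(a)} D^{(a+1)} ⋯ D^{(b-1)}`, where `D^{(r)}` has the parameter `β r`. -/
def diffChain (β : ℕ → ℂ) (a b : ℕ) (f : ℕ → ℂ) : ℕ → ℂ :=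
  (List.Ico a b).foldr (fun r g => diffOp (β r) g) f

/-- `D^{[a,b)†} = D^{(a)†} D^{(a+1)†} ⋯ D^{(b-1)†}`. -/
def diffChainDagger (β : ℕ → ℂ) (a b : ℕ) (f : ℕ → ℂ) : ℕ → ℂ :=
  (List.Ico a b).foldr (fun r g => diffOpDagger (β r) g) f

/-- `N`-point configurations `ℓ₁ > ℓ₂ > ⋯ > ℓ_N ≥ 0`. -/
abbrev Config (N : ℕ) : Type := {l : Fin N → ℕ // StrictAnti l}

variable {N : ℕ}

/-- The weight `W(X) = det[D^{[1,j)} Φ_i(ℓ_j)] det[D^{[j,N)†} Ψ_i(ℓ_j)]`. -/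
def weight (Φ Ψ : Fin N → ℕ → ℂ) (β : ℕ → ℂ) (X : Config N) : ℂ :=
  (Matrix.of fun i j : Fin N => diffChain β 1 (j + 1) (Φ i) (X.1 j)).det *
    (Matrix.of fun i j : Fin N => diffChainDagger β (j + 1) N (Ψ i) (X.1 j)).det

/-- The normalizing constant `Z = ∑_X W(X)`. If the series does not converge, this is `0`, so
that `Z ≠ 0` says that the series converges and that its sum is nonzero. -/
def normConst (Φ Ψ : Fin N → ℕ → ℂ) (β : ℕ → ℂ) : ℂ :=
  ∑' X : Config N, weight Φ Ψ β X

/-- The normalized weights `M(X) = W(X) / Z` of the tilted biorthogonal ensemble. -/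
def ensemble (Φ Ψ : Fin N → ℕ → ℂ) (β : ℕ → ℂ) (X : Config N) : ℂ :=
  weight Φ Ψ β X / normConst Φ Ψ β

/-- The (complex valued) probability `M(E)` of an event `E`. -/
def prob (Φ Ψ : Fin N → ℕ → ℂ) (β : ℕ → ℂ) (E : Set (Config N)) : ℂ :=
  ∑' X : E, ensemble Φ Ψ β X.1

/-- `T_b(x, y) = 1_{y = x} - b 1_{y = x - 1}` for `x, y ≥ 0`. -/
def transition (b : ℂ) (x y : ℕ) : ℂ :=
  (if y = x then 1 else 0) - b * (if y + 1 = x then 1 else 0)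

/-- Discrete convolution of functions of two variables. -/
def conv (f g : ℕ → ℕ → ℂ) (x y : ℕ) : ℂ := ∑' z : ℕ, f x z * g z y

/-- `T_{β_s} * T_{β_{s+1}} * ⋯ * T_{β_{t-1}}` for `s < t` (and the identity for `t ≤ s`). -/
def transitionChain (β : ℕ → ℂ) (s t : ℕ) : ℕ → ℕ → ℂ :=
  (List.Ico s t).foldr (fun r g => conv (transition (β r)) g) (fun x y => if x = y then 1 else 0)

/-- The general term
`Φ_i(y₁) T_{β₁}(y₁, y₂) ⋯ T_{β_{N-1}}(y_{N-1}, y_N) Ψ_j(y_N)` of the multiple series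
`Φ_i * T_{β₁} * ⋯ * T_{β_{N-1}} * Ψ_j`. -/
def convTerm (Φ Ψ : Fin N → ℕ → ℂ) (β : ℕ → ℂ) (i j : Fin N) (y : Fin N → ℕ) : ℂ :=
  Φ i (y ⟨0, i.pos⟩) *
    (∏ m : Fin (N - 1),
      transition (β (m + 1)) (y ⟨m, by omega⟩) (y ⟨m + 1, by omega⟩)) *
    Ψ j (y ⟨N - 1, by have := i.pos; omega⟩)

/-- All series `Φ_i * T_{β₁} * ⋯ * T_{β_{N-1}} * Ψ_j` converge absolutely (summability of a family
of complex numbers is absolute summability). -/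
def ConvolutionsConverge (Φ Ψ : Fin N → ℕ → ℂ) (β : ℕ → ℂ) : Prop :=
  ∀ i j : Fin N, Summable (convTerm Φ Ψ β i j)

/-- The Gram matrix `G_{ij} = ∑_{k ≥ 0} Ψ_j(k) D^{[1,N)} Φ_i(k)`. -/
def gram (Φ Ψ : Fin N → ℕ → ℂ) (β : ℕ → ℂ) : Matrix (Fin N) (Fin N) ℂ :=
  Matrix.of fun i j => ∑' k : ℕ, Ψ j k * diffChain β 1 N (Φ i) k

/-- Points `(x, t)` of `ℤ_{≥0} × {1, …, N}`. -/
abbrev Point (N : ℕ) : Type := ℕ × Fin N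

/-- The two-dimensional correlation kernel
`K(x,t;y,s) = -1_{t>s} (T_{β_s} * ⋯ * T_{β_{t-1}})(y,x)
  + ∑_{i,j} (G⁻¹)_{ji} D^{[1,t)} Φ_i(x) D^{[s,N)†} Ψ_j(y)`. -/
def kernel (Φ Ψ : Fin N → ℕ → ℂ) (β : ℕ → ℂ) (u v : Point N) : ℂ :=
  -(if v.2 < u.2 then transitionChain β (v.2 + 1) (u.2 + 1) v.1 u.1 else 0) +
    ∑ i : Fin N, ∑ j : Fin N, (gram Φ Ψ β)⁻¹ j i *
      diffChain β 1 (u.2 + 1) (Φ i) u.1 * diffChainDagger β (v.2 + 1) N (Ψ j) v.1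

/-- `B_i(a) = {0, 1, …, a-1} × {i}`. -/
def setB (i : Fin N) (a : ℕ) : Finset (Point N) := Finset.range a ×ˢ {i}

/-- `C_i(a) = {a} × {i}`. -/
def setC (i : Fin N) (a : ℕ) : Finset (Point N) := {a} ×ˢ {i}

/-- The union `F` of the sets `B_{i_p}(a_p) ∪ C_{i_p}(a_p)` over `p = 1, …, k`. -/
def setF {k : ℕ} (i : Fin k → Fin N) (a : Fin k → ℕ) : Finset (Point N) :=
  Finset.univ.biUnion fun p => setB (i p) (a p) ∪ setC (i p) (a p)

/-- The variable `z_p`. -/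
def varZ (R : Type) [CommRing R] {k : ℕ} (p : Fin k) : MvPolynomial (Fin k ⊕ Fin k) R :=
  MvPolynomial.X (Sum.inl p)

/-- The variable `w_p`. -/
def varW (R : Type) [CommRing R] {k : ℕ} (p : Fin k) : MvPolynomial (Fin k ⊕ Fin k) R :=
  MvPolynomial.X (Sum.inr p)

/-- The matrix
`1 - χ_F ∑_p (1 - z_p) K χ_{B_{i_p}(a_p)} - χ_F ∑_p (1 - w_p) K χ_{C_{i_p}(a_p)}`
with rows and columns indexed by `F`. -/
def blockMatrix (K : Point N → Point N → ℂ) {k : ℕ} (i : Fin k → Fin N) (a : Fin k → ℕ) :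
    Matrix (setF i a) (setF i a) (MvPolynomial (Fin k ⊕ Fin k) ℂ) :=
  Matrix.of fun u v =>
    (if u = v then 1 else 0)
      - ∑ p : Fin k, (1 - varZ ℂ p) *
          (if v.1 ∈ setB (i p) (a p) then MvPolynomial.C (K u.1 v.1) else 0)
      - ∑ p : Fin k, (1 - varW ℂ p) *
          (if v.1 ∈ setC (i p) (a p) then MvPolynomial.C (K u.1 v.1) else 0)

/-- The exponent of the monomial `z₁^{N-i₁} ⋯ z_k^{N-i_k} w₁ ⋯ w_k`. -/
def targetExponent {k : ℕ} (i : Fin k → Fin N) : (Fin k ⊕ Fin k) →₀ ℕ :=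
  Finsupp.equivFunOnFinite.symm (Sum.elim (fun p => N - ((i p : ℕ) + 1)) (fun _ => 1))

/-- The coefficient of `z₁^{N-i₁} ⋯ z_k^{N-i_k} w₁ ⋯ w_k` in the determinant of `blockMatrix`. -/
def detCoeff (K : Point N → Point N → ℂ) {k : ℕ} (i : Fin k → Fin N) (a : Fin k → ℕ) : ℂ :=
  MvPolynomial.coeff (targetExponent i) (blockMatrix K i a).det

/-- The decreasing rearrangement of a tuple. -/
def decreasing {k : ℕ} (a : Fin k → ℕ) : Fin k → ℕ := fun p => a (Tuple.sort a p.rev)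

end TiltedEnsemble

end

/-!
The ensemble is the diagonal `ℓ_t = x^t_t` of an ensemble of nonintersecting paths
`X^1, …, X^N`, where `X^t = (x^t_1 > ⋯ > x^t_N)` is the configuration at level `t` and the weight is
`det Φ_i(x^1_j) ∏_t det T_{β_t}(x^t_i, x^{t+1}_j) det Ψ_i(x^N_j)`. Since `T_b` moves a point by at
most one step down, each determinant of transitions is the product of its diagonal entries
(`pathSum` is the sum over the paths). For a given diagonal, the parts of the paths after and before
it can be summed out one level at a time without the nonintersection constraint, because
configurations with a collision cancel in a determinant (`pathSum_eq_frozenTransfer`,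
`sum_tailDet_mul_frozenTransfer`); what remains is the weight `W`.

At level `t` the diagonal point is at `a` if and only if one point is at `a` and `N - t` points are
below it. So a marginal of `W` is the coefficient of `∏ z_p^{N - i_p} w_p` in the generating
function in which each point of level `i_p` is weighted by `z_p` below `a_p` and by `w_p` at `a_p`
(`coeff_det_pairing`). By the Cauchy–Binet formula the generating function is an `N × N`
determinant, and the Eynard–Mehta argument (`det_weighted_eq_det_mul_fredholm`) turns it into
`det G` times the determinant of `1 - K (1 - g)` on the finite set where the weight `g` is not `1`.

All of this is finite linear algebra if the `Φ_i` are cut off to `{0, …, M - 1}`, which restricts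
`W` exactly to the configurations below `M` (`det_diffChain_trunc`). As `M → ∞` the sums of `W`
converge because `Z ≠ 0` presupposes summability, and the Gram matrix and the kernel converge by
dominated convergence (`tendsto_gram_trunc`). The case without marked points gives `det G = Z`.

For the correlation functions, a configuration that contains `a_1, …, a_k` has these points at a
unique increasing tuple of indices, in decreasing order.
-/

noncomputable section

namespace TiltedEnsemble

/-! ### Determinants of sums and the Cauchy–Binet formula -/

theorem strictAnti_eq_of_range_eq {α : Type*} [LinearOrder α] {n : ℕ} {x y : Fin n → α}
    (hx : StrictAnti x) (hy : StrictAnti y) (h : Set.range x = Set.range y) : x = y := by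
  have := (StrictMono.range_inj (f := OrderDual.toDual ∘ x) (g := OrderDual.toDual ∘ y)
    hx.dual_right hy.dual_right).1 (by rw [Set.range_comp, Set.range_comp, h])
  exact this

theorem strictAnti_sort_rev {α : Type*} [LinearOrder α] {n : ℕ} {y : Fin n → α}
    (hy : Function.Injective y) : StrictAnti fun p : Fin n => y (Tuple.sort y p.rev) := by
  have h : StrictMono (y ∘ Tuple.sort y) :=
    (Tuple.monotone_sort y).strictMono_of_injective (hy.comp (Tuple.sort y).injective)
  exact fun p q hpq => h (Fin.rev_lt_rev.2 hpq)

theorem det_sum_columns {ι α R : Type*} [Fintype ι] [DecidableEq ι] [Fintype α] [CommRing R]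
    (k : ι → α → R) (f : ι → ι → α → R) :
    (Matrix.of fun i j => ∑ y, k j y * f i j y).det =
      ∑ y : ι → α, (∏ j, k j (y j)) * (Matrix.of fun i j => f i j (y j)).det := by
  classical
  simp only [Matrix.det_apply', Matrix.of_apply, Finset.prod_univ_sum, Fintype.piFinset_univ,
    Finset.mul_sum, Finset.prod_mul_distrib]
  rw [Finset.sum_comm]
  exact Finset.sum_congr rfl fun y _ => Finset.sum_congr rfl fun σ _ => by ring

theorem det_columns_eq_zero {ι α R : Type*} [Fintype ι] [DecidableEq ι] [CommRing R]
    (f : ι → ι → α → R) (y : ι → α) {j j' : ι} (hne : j ≠ j') (hy : y j = y j')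
    (hf : ∀ i, f i j = f i j') : (Matrix.of fun i j => f i j (y j)).det = 0 :=
  Matrix.det_zero_of_column_eq hne fun i => by simp [hf, hy]

/-- Every injective tuple is a permutation of exactly one strictly decreasing tuple. -/
theorem sum_injective_eq_sum_strictAnti {α R : Type*} [LinearOrder α] [Fintype α]
    [AddCommMonoid R] {n : ℕ} [DecidablePred fun y : Fin n → α => Function.Injective y]
    [DecidablePred fun y : Fin n → α => StrictAnti y] (F : (Fin n → α) → R) :
    ∑ y : Fin n → α with Function.Injective y, F y =
      ∑ x : Fin n → α with StrictAnti x, ∑ σ : Equiv.Perm (Fin n), F (x ∘ σ) := by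
  rw [← Finset.sum_product']
  symm
  refine Finset.sum_bij (fun p _ => p.1 ∘ p.2) ?_ ?_ ?_ ?_
  · rintro ⟨x, σ⟩ h
    simp only [mem_product, mem_filter, mem_univ, true_and, and_true] at h ⊢
    exact h.injective.comp σ.injective
  · rintro ⟨x, σ⟩ h ⟨x', σ'⟩ h' he
    simp only [mem_product, mem_filter, mem_univ, true_and, and_true] at h h' he
    have hxx : x = x' := strictAnti_eq_of_range_eq h h' (by
      rw [← σ.surjective.range_comp x, he, σ'.surjective.range_comp])
    subst hxx
    have : σ = σ' := Equiv.ext fun i => h.injective (congrFun he i)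
    rw [this]
  · intro y hy
    simp only [mem_filter, mem_univ, true_and] at hy
    refine ⟨(fun p => y (Tuple.sort y p.rev), (Fin.revPerm.trans (Tuple.sort y))⁻¹), ?_, ?_⟩
    · simpa using strictAnti_sort_rev hy
    · funext i
      have := (Fin.revPerm.trans (Tuple.sort y)).apply_symm_apply i
      exact congrArg y this
  · intros; rfl

/-- The Cauchy–Binet formula. -/
theorem det_mul_eq_sum_strictAnti {α R : Type*} [LinearOrder α] [Fintype α] [CommRing R] {n : ℕ}
    [DecidablePred fun y : Fin n → α => StrictAnti y] (a b : Fin n → α → R) :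
    (Matrix.of fun i j => ∑ x, a i x * b j x).det =
      ∑ x : Fin n → α with StrictAnti x,
        (Matrix.of fun i j => a i (x j)).det * (Matrix.of fun i j => b i (x j)).det := by
  classical
  have h1 : (Matrix.of fun i j => ∑ x, a i x * b j x).det =
      ∑ y : Fin n → α, (∏ j, b j (y j)) * (Matrix.of fun i j => a i (y j)).det := by
    rw [← det_sum_columns (fun j y => b j y) (fun i _ y => a i y)]
    simp only [mul_comm]
  rw [h1, ← Finset.sum_filter_of_ne (p := Function.Injective), sum_injective_eq_sum_strictAnti]
  · refine Finset.sum_congr rfl fun x _ => ?_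
    have h2 : ∀ σ : Equiv.Perm (Fin n), (Matrix.of fun i j => a i ((x ∘ σ) j)).det =
        Equiv.Perm.sign σ * (Matrix.of fun i j => a i (x j)).det := fun σ =>
      Matrix.det_permute' σ (Matrix.of fun i j => a i (x j))
    simp only [h2]
    rw [Matrix.det_apply' (Matrix.of fun i j => b i (x j)), Finset.mul_sum,
      ← Equiv.sum_comp (Equiv.inv (Equiv.Perm (Fin n)))]
    refine Finset.sum_congr rfl fun σ _ => ?_
    have h3 : ∏ j, b j ((x ∘ (σ⁻¹ : Equiv.Perm (Fin n))) j) = ∏ j, b (σ j) (x j) := by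
      rw [← Equiv.prod_comp σ]; simp
    simp only [Equiv.inv_apply, h3, Equiv.Perm.sign_inv, Matrix.of_apply]
    ring
  · intro y _ hy
    by_contra hni
    simp only [Function.Injective, not_forall] at hni
    obtain ⟨i, j, hij, hne⟩ := hni
    exact hy (by rw [det_columns_eq_zero (fun i _ y => a i y) y hne hij fun _ => rfl, mul_zero])

/-! ### Tensor powers of matrices -/

/-- The tensor product of the matrices `k j`, acting on functions of tuples: the `j`-th factor acts
on the `j`-th coordinate. -/
def tens {ι α R : Type*} [Fintype ι] [CommRing R] (k : ι → Matrix α α R) :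
    Matrix (ι → α) (ι → α) R :=
  Matrix.of fun x y => ∏ j, k j (x j) (y j)

theorem tens_mul {ι α R : Type*} [Fintype ι] [DecidableEq ι] [Fintype α] [CommRing R]
    (k l : ι → Matrix α α R) : tens k * tens l = tens fun j => k j * l j := by
  classical
  ext x z
  simp only [tens, Matrix.mul_apply, Matrix.of_apply, Finset.prod_univ_sum,
    Fintype.piFinset_univ, Finset.prod_mul_distrib]

theorem tens_mulVec_det {ι α R : Type*} [Fintype ι] [DecidableEq ι] [Fintype α] [CommRing R]
    (k : ι → Matrix α α R) (f : ι → ι → α → R) :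
    (tens k).mulVec (fun y => (Matrix.of fun i j => f i j (y j)).det) =
      fun x => (Matrix.of fun i j => ((k j).mulVec (f i j)) (x j)).det := by
  funext x
  simp only [Matrix.mulVec, dotProduct, tens, Matrix.of_apply]
  exact (det_sum_columns (fun j y => k j (x j) y) f).symm

theorem tens_vecMul_det {ι α R : Type*} [Fintype ι] [DecidableEq ι] [Fintype α] [CommRing R]
    (k : ι → Matrix α α R) (f : ι → ι → α → R) :
    (tens k).vecMul (fun y => (Matrix.of fun i j => f i j (y j)).det) =
      fun x => (Matrix.of fun i j => ((k j).vecMul (f i j)) (x j)).det := by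
  funext x
  simp only [Matrix.vecMul, dotProduct, tens, Matrix.of_apply]
  have := det_sum_columns (fun j y => k j y (x j)) f
  simp only [mul_comm (k _ _ _)] at this
  rw [this]
  exact Finset.sum_congr rfl fun y _ => mul_comm _ _

/-! ### Nonintersecting paths with marked diagonal -/

section Paths

variable {N M : ℕ} {R : Type*} [CommRing R]

/-- A matrix whose only nonzero entries are at `y = x` and `y = x - 1`. -/
def IsDescending (T : Matrix (Fin M) (Fin M) R) : Prop :=
  ∀ x y, T x y ≠ 0 → y ≤ x ∧ (x : ℕ) ≤ y + 1

open Classical in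
/-- The indicator that the coordinates with index at least `s` are strictly decreasing. -/
def ordInd (s : ℕ) (x : Fin N → Fin M) : R :=
  if ∀ i j : Fin N, s ≤ i → i < j → x j < x i then 1 else 0

/-- The matrix `T` acting on the coordinates with index at most `s`. -/
def moveHead (T : Matrix (Fin M) (Fin M) R) (s : ℕ) :
    Matrix (Fin N → Fin M) (Fin N → Fin M) R :=
  tens fun j => if (j : ℕ) ≤ s then T else 1

/-- The matrix `T` acting on the coordinates with index greater than `s`. -/
def moveTail (T : Matrix (Fin M) (Fin M) R) (s : ℕ) :
    Matrix (Fin N → Fin M) (Fin N → Fin M) R :=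
  tens fun j => if (j : ℕ) ≤ s then 1 else T

/-- The sum over the nonintersecting paths that start at level `s` and make `n` steps, with the
weight `c t` at each level `t` and the weight `v` at the last level, as a function of the starting
configuration. -/
def pathSum (T : ℕ → Matrix (Fin M) (Fin M) R) (c : ℕ → (Fin N → Fin M) → R)
    (v : (Fin N → Fin M) → R) : ℕ → ℕ → (Fin N → Fin M) → R
  | 0, s => fun x => ordInd 0 x * (c s x * v x)
  | n + 1, s => fun x =>
      ordInd 0 x * (c s x * (tens fun _ => T s).mulVec (pathSum T c v n (s + 1)) x)

/-- The transfer matrix from level `s` over `n` steps in which the `j`-th path is frozen from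
level `j` on, and in which only the paths that are not yet frozen, and the one being frozen, are
required not to intersect. -/
def frozenTransfer (T : ℕ → Matrix (Fin M) (Fin M) R) (c : ℕ → (Fin N → Fin M) → R) :
    ℕ → ℕ → Matrix (Fin N → Fin M) (Fin N → Fin M) R
  | 0, s => Matrix.diagonal fun x => c s x * ordInd s x
  | n + 1, s => Matrix.diagonal (fun x => c s x * ordInd s x) *
      (moveTail (T s) s * frozenTransfer T c n (s + 1))

/-- Each weight `c s` depends only on the coordinate with index `s`. -/
def DiagonalWeights (c : ℕ → (Fin N → Fin M) → R) : Prop :=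
  ∀ (s : ℕ) (x y : Fin N → Fin M), (∀ j : Fin N, (j : ℕ) = s → x j = y j) → c s x = c s y

variable {T : ℕ → Matrix (Fin M) (Fin M) R} {c : ℕ → (Fin N → Fin M) → R}

theorem ordInd_congr {s : ℕ} {x y : Fin N → Fin M} (h : ∀ j : Fin N, s ≤ j → x j = y j) :
    (ordInd s x : R) = ordInd s y := by
  unfold ordInd
  congr 1
  refine propext (forall₂_congr fun i j => ?_)
  refine forall₂_congr fun hi hij => ?_
  rw [h i hi, h j (hi.trans (le_of_lt hij))]

theorem ordInd_of_forall {s : ℕ} {x : Fin N → Fin M}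
    (h : ∀ i j : Fin N, s ≤ i → i < j → x j < x i) : (ordInd s x : R) = 1 := if_pos h

theorem ordInd_of_not {s : ℕ} {x : Fin N → Fin M}
    (h : ¬ ∀ i j : Fin N, s ≤ i → i < j → x j < x i) : (ordInd s x : R) = 0 := if_neg h

theorem forall_of_ordInd_ne_zero {s : ℕ} {x : Fin N → Fin M} (h : (ordInd s x : R) ≠ 0) :
    ∀ i j : Fin N, s ≤ i → i < j → x j < x i := by
  by_contra hn
  exact h (ordInd_of_not hn)

theorem ordInd_zero_mul (s : ℕ) (x : Fin N → Fin M) :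
    (ordInd 0 x : R) * ordInd s x = ordInd 0 x := by
  by_cases h : ∀ i j : Fin N, 0 ≤ (i : ℕ) → i < j → x j < x i
  · rw [ordInd_of_forall h, ordInd_of_forall fun i j _ hij => h i j (Nat.zero_le _) hij, mul_one]
  · rw [ordInd_of_not h, zero_mul]

theorem ordInd_zero_eq_ite (x : Fin N → Fin M) [Decidable (StrictAnti x)] :
    (ordInd 0 x : R) = if StrictAnti x then 1 else 0 := by
  unfold ordInd
  by_cases h : StrictAnti x
  · rw [if_pos h, if_pos fun i j _ hij => h hij]
  · rw [if_neg h, if_neg fun h' => h fun i j hij => h' i j (Nat.zero_le _) hij]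

theorem tens_ne_zero {k : Fin N → Matrix (Fin M) (Fin M) R} {x y : Fin N → Fin M}
    (h : tens k x y ≠ 0) (j : Fin N) : k j (x j) (y j) ≠ 0 := fun h0 =>
  h (Finset.prod_eq_zero (mem_univ j) h0)

theorem eq_of_moveTail_ne_zero {A : Matrix (Fin M) (Fin M) R} {s : ℕ} {x y : Fin N → Fin M}
    (h : moveTail A s x y ≠ 0) {j : Fin N} (hj : (j : ℕ) ≤ s) : x j = y j := by
  have := tens_ne_zero h j
  rw [if_pos hj] at this
  by_contra hne
  exact this (Matrix.one_apply_ne hne)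

theorem eq_of_moveHead_ne_zero {A : Matrix (Fin M) (Fin M) R} {s : ℕ} {x y : Fin N → Fin M}
    (h : moveHead A s x y ≠ 0) {j : Fin N} (hj : s < j) : x j = y j := by
  have := tens_ne_zero h j
  rw [if_neg (not_le.2 hj)] at this
  by_contra hne
  exact this (Matrix.one_apply_ne hne)

theorem le_of_moveTail_ne_zero {A : Matrix (Fin M) (Fin M) R} (hA : IsDescending A) {s : ℕ}
    {x y : Fin N → Fin M} (h : moveTail A s x y ≠ 0) (j : Fin N) :
    y j ≤ x j ∧ (x j : ℕ) ≤ y j + 1 := by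
  by_cases hj : (j : ℕ) ≤ s
  · rw [eq_of_moveTail_ne_zero h hj]; simp
  · have := tens_ne_zero h j
    rw [if_neg hj] at this
    exact hA _ _ this

theorem moveTail_mul_moveHead (A : Matrix (Fin M) (Fin M) R) (s : ℕ) :
    moveTail (N := N) A s * moveHead A s = tens fun _ => A := by
  unfold moveTail moveHead
  rw [tens_mul]
  congr 1
  funext j
  split_ifs <;> simp

theorem commute_moveHead_moveTail (A B : Matrix (Fin M) (Fin M) R) {s t : ℕ} (h : s ≤ t) :
    Commute (moveHead (N := N) A s) (moveTail B t) := by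
  unfold Commute SemiconjBy moveTail moveHead
  rw [tens_mul, tens_mul]
  congr 1
  funext j
  by_cases hj : (j : ℕ) ≤ s
  · simp [hj, hj.trans h]
  · simp [hj]

theorem commute_moveHead_diagonal (A : Matrix (Fin M) (Fin M) R) {s : ℕ}
    {d : (Fin N → Fin M) → R}
    (hd : ∀ x y : Fin N → Fin M, (∀ j : Fin N, s < j → x j = y j) → d x = d y) :
    Commute (moveHead A s) (Matrix.diagonal d) := by
  classical
  unfold Commute SemiconjBy
  ext x y
  rw [Matrix.mul_diagonal, Matrix.diagonal_mul]
  by_cases h : moveHead A s x y = 0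
  · simp [h]
  · rw [hd x y fun j hj => eq_of_moveHead_ne_zero h hj, mul_comm]

theorem commute_moveHead_weight (hc : DiagonalWeights c) (A : Matrix (Fin M) (Fin M) R) {s t : ℕ}
    (h : s < t) :
    Commute (moveHead A s) (Matrix.diagonal fun x => c t x * ordInd t x) := by
  refine commute_moveHead_diagonal A fun x y hxy => ?_
  rw [hc t x y fun j hj => hxy j (by omega), ordInd_congr fun j hj => hxy j (by omega)]

theorem commute_moveHead_frozenTransfer (hc : DiagonalWeights c) (A : Matrix (Fin M) (Fin M) R)
    (n : ℕ) {s t : ℕ} (h : s < t) : Commute (moveHead A s) (frozenTransfer T c n t) := by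
  induction n generalizing t with
  | zero => exact commute_moveHead_weight hc A h
  | succ n ih =>
    exact (commute_moveHead_weight hc A h).mul_right
      ((commute_moveHead_moveTail A _ h.le).mul_right (ih (by omega)))

theorem frozenTransfer_eq_diagonal_mul (n s : ℕ) : ∃ Q : Matrix _ _ R,
    frozenTransfer T c n s = Matrix.diagonal (fun x => c s x * ordInd s x) * Q := by
  cases n with
  | zero => exact ⟨1, by rw [mul_one]; rfl⟩
  | succ n => exact ⟨_, rfl⟩

theorem forall_of_frozenTransfer_ne_zero {n s : ℕ} {x y : Fin N → Fin M}
    (h : frozenTransfer T c n s x y ≠ 0) : ∀ i j : Fin N, s ≤ i → i < j → x j < x i := by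
  obtain ⟨Q, hQ⟩ := frozenTransfer_eq_diagonal_mul (T := T) (c := c) n s
  rw [hQ, Matrix.diagonal_mul] at h
  exact forall_of_ordInd_ne_zero (right_ne_zero_of_mul (left_ne_zero_of_mul h))

theorem eq_of_frozenTransfer_ne_zero {n s : ℕ} {x y : Fin N → Fin M}
    (h : frozenTransfer T c n s x y ≠ 0) {j : Fin N} (hj : (j : ℕ) ≤ s) : x j = y j := by
  induction n generalizing s x with
  | zero =>
    by_contra hne
    exact h (Matrix.diagonal_apply_ne _ fun hxy => hne (by rw [hxy]))
  | succ n ih =>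
    rw [frozenTransfer, Matrix.diagonal_mul, Matrix.mul_apply] at h
    obtain ⟨z, -, hz⟩ := Finset.exists_ne_zero_of_sum_ne_zero (right_ne_zero_of_mul h)
    rw [eq_of_moveTail_ne_zero (left_ne_zero_of_mul hz) hj]
    exact ih (right_ne_zero_of_mul hz) (by omega)

/-- The determinant with the column functions `ψ (max j s)`: the paths with index at most `s` are
at level `s`, and each later path is at the level at which it is frozen. -/
def headDet (ψ : ℕ → Fin N → Fin M → R) (s : ℕ) (x : Fin N → Fin M) : R :=
  (Matrix.of fun i j : Fin N => ψ (max j s) i (x j)).det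

/-- The determinant with the column functions `φ (min j s)`: the paths with index at least `s` are
at level `s`, and each earlier path is at the level at which it is frozen. -/
def tailDet (φ : ℕ → Fin N → Fin M → R) (s : ℕ) (x : Fin N → Fin M) : R :=
  (Matrix.of fun i j : Fin N => φ (min j s) i (x j)).det

theorem moveHead_mulVec_headDet {ψ : ℕ → Fin N → Fin M → R} {s : ℕ}
    (hψ : ∀ i, ψ s i = (T s).mulVec (ψ (s + 1) i)) :
    (moveHead (T s) s).mulVec (headDet ψ (s + 1)) = headDet ψ s := by
  unfold moveHead headDet
  rw [tens_mulVec_det _ fun i (j : Fin N) => ψ (max j (s + 1)) i]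
  funext x
  congr 2
  funext i j
  by_cases hj : (j : ℕ) ≤ s
  · rw [if_pos hj, max_eq_right (by omega), max_eq_right hj, hψ]
  · rw [if_neg hj, max_eq_left (by omega), max_eq_left (by omega), Matrix.one_mulVec]

theorem moveTail_vecMul_tailDet {φ : ℕ → Fin N → Fin M → R} {s : ℕ}
    (hφ : ∀ i, φ (s + 1) i = (T s).vecMul (φ s i)) :
    (moveTail (T s) s).vecMul (tailDet φ s) = tailDet φ (s + 1) := by
  unfold moveTail tailDet
  rw [tens_vecMul_det _ fun i (j : Fin N) => φ (min j s) i]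
  funext x
  congr 2
  funext i j
  by_cases hj : (j : ℕ) ≤ s
  · rw [if_pos hj, min_eq_left hj, min_eq_left (by omega), Matrix.vecMul_one]
  · rw [if_neg hj, min_eq_right (by omega), min_eq_right (by omega), hφ]

theorem headDet_eq_zero {ψ : ℕ → Fin N → Fin M → R} {s : ℕ} {x : Fin N → Fin M} {i j : Fin N}
    (hij : i < j) (hj : (j : ℕ) ≤ s) (h : x i = x j) : headDet ψ s x = 0 :=
  det_columns_eq_zero (fun i (j : Fin N) => ψ (max j s) i) x hij.ne h fun l => by
    have : (i : ℕ) < j := hij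
    rw [max_eq_right hj, max_eq_right (by omega)]

theorem tailDet_eq_zero {φ : ℕ → Fin N → Fin M → R} {s : ℕ} {x : Fin N → Fin M} {i j : Fin N}
    (hij : i < j) (hi : s ≤ i) (h : x i = x j) : tailDet φ s x = 0 :=
  det_columns_eq_zero (fun i (j : Fin N) => φ (min j s) i) x hij.ne h fun l => by
    have : (i : ℕ) < j := hij
    rw [min_eq_right hi, min_eq_right (by omega)]

/-- In a sum over nonintersecting paths, the part of each path after the level that equals its
index can be summed out without the nonintersection constraint, since the configurations with
collisions cancel in the determinant. -/
theorem pathSum_eq_frozenTransfer (hc : DiagonalWeights c) (hT : ∀ s, IsDescending (T s))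
    {ψ : ℕ → Fin N → Fin M → R}
    (hψ : ∀ s, s + 1 < N → ∀ i, ψ s i = (T s).mulVec (ψ (s + 1) i))
    (n s : ℕ) (hn : s + n < N) :
    pathSum T c (headDet ψ (s + n)) n s =
      fun x => ordInd 0 x * (frozenTransfer T c n s).mulVec (headDet ψ s) x := by
  induction n generalizing s with
  | zero =>
    funext x
    rw [frozenTransfer, Matrix.mulVec_diagonal, add_zero]
    change ordInd 0 x * (c s x * _) = _
    linear_combination (-(c s x * headDet ψ s x)) * ordInd_zero_mul (R := R) s x
  | succ n ih =>
    funext x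
    have h1 := ih (s + 1) (by omega)
    rw [show s + 1 + n = s + (n + 1) by omega] at h1
    rw [pathSum, h1, frozenTransfer, ← Matrix.mulVec_mulVec, Matrix.mulVec_diagonal]
    rw [mul_comm (c s x) (ordInd s x), mul_assoc, ← mul_assoc (ordInd 0 x), ordInd_zero_mul]
    have h2 : (moveTail (T s) s * frozenTransfer T c n (s + 1)).mulVec (headDet ψ s) =
        (tens fun _ : Fin N => T s).mulVec
          ((frozenTransfer T c n (s + 1)).mulVec (headDet ψ (s + 1))) := by
      rw [← moveTail_mul_moveHead _ s, Matrix.mulVec_mulVec, mul_assoc,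
        (commute_moveHead_frozenTransfer hc (T s) n (Nat.lt_succ_self s)).eq, ← mul_assoc,
        ← Matrix.mulVec_mulVec _ _ (moveHead (T s) s), moveHead_mulVec_headDet (hψ s (by omega))]
    rw [h2]
    change ordInd 0 x * (c s x * _) = _
    by_cases hx : ∀ i j : Fin N, 0 ≤ (i : ℕ) → i < j → x j < x i
    swap
    · rw [ordInd_of_not hx, zero_mul, zero_mul]
    congr 2
    refine Finset.sum_congr rfl fun y _ => ?_
    change tens (fun _ : Fin N => T s) x y * (ordInd 0 y *
      (frozenTransfer T c n (s + 1)).mulVec (headDet ψ (s + 1)) y) =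
        tens (fun _ : Fin N => T s) x y * _
    by_cases hxy : tens (fun _ : Fin N => T s) x y = 0
    · rw [hxy, zero_mul, zero_mul]
    by_cases hy : (frozenTransfer T c n (s + 1)).mulVec (headDet ψ (s + 1)) y = 0
    · rw [hy, mul_zero, mul_zero]
    obtain ⟨z, -, hz⟩ := Finset.exists_ne_zero_of_sum_ne_zero hy
    have hfro : ∀ j : Fin N, (j : ℕ) ≤ s + 1 → y j = z j := fun j hj =>
      eq_of_frozenTransfer_ne_zero (left_ne_zero_of_mul hz) hj
    have htail := forall_of_frozenTransfer_ne_zero (left_ne_zero_of_mul hz)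
    have hle : ∀ i j : Fin N, i < j → y j ≤ y i := fun i j hij => by
      have h1 := (hT s _ _ (tens_ne_zero hxy i)).2
      have h2 := (hT s _ _ (tens_ne_zero hxy j)).1
      have h3 := hx i j (Nat.zero_le _) hij
      rw [Fin.le_def] at h2 ⊢
      rw [Fin.lt_def] at h3
      omega
    rw [ordInd_of_forall, one_mul]
    intro i j _ hij
    by_cases hi : s + 1 ≤ i
    · exact htail i j hi hij
    by_cases hj : (j : ℕ) ≤ s + 1
    · refine lt_of_le_of_ne (hle i j hij) fun he => right_ne_zero_of_mul hz ?_
      refine headDet_eq_zero hij hj ?_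
      rw [← hfro i (by omega), ← hfro j hj, he]
    · have hs : s + 1 < N := by omega
      exact (htail ⟨s + 1, hs⟩ j le_rfl (by rw [Fin.lt_def]; simp only; omega)).trans_le
        (hle i ⟨s + 1, hs⟩ (by rw [Fin.lt_def]; simp only; omega))

/-- The part of each path before the level that equals its index is summed out one level at a
time. The configurations with collisions cancel in the determinant. -/
theorem sum_tailDet_mul_frozenTransfer (hc : DiagonalWeights c) (hT : ∀ s, IsDescending (T s))
    {φ : ℕ → Fin N → Fin M → R}
    (hφ : ∀ s, s + 1 < N → ∀ i, φ (s + 1) i = (T s).vecMul (φ s i))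
    (v : (Fin N → Fin M) → R) (n s : ℕ) (hn : s + n < N) :
    ∑ x, tailDet φ s x * ordInd 0 x * (∏ t ∈ range s, c t x) *
        (frozenTransfer T c n s).mulVec v x =
      ∑ x, tailDet φ (s + n) x * ordInd 0 x * (∏ t ∈ range (s + n + 1), c t x) * v x := by
  induction n generalizing s with
  | zero =>
    refine Finset.sum_congr rfl fun x _ => ?_
    rw [frozenTransfer, Matrix.mulVec_diagonal, add_zero, Finset.prod_range_succ]
    linear_combination (tailDet φ s x * (∏ t ∈ range s, c t x) * c s x * v x) *
      ordInd_zero_mul (R := R) s x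
  | succ n ih =>
    rw [show s + (n + 1) = s + 1 + n by omega, ← ih (s + 1) (by omega)]
    set w := (frozenTransfer T c n (s + 1)).mulVec v with hw
    have h1 : ∀ x, tailDet φ s x * ordInd 0 x * (∏ t ∈ range s, c t x) *
        (frozenTransfer T c (n + 1) s).mulVec v x =
        ∑ y, (tailDet φ s x * ordInd 0 x * (∏ t ∈ range (s + 1), c t x)) *
          (moveTail (T s) s x y * w y) := fun x => by
      rw [frozenTransfer, ← Matrix.mulVec_mulVec, Matrix.mulVec_diagonal, ← Matrix.mulVec_mulVec,
        ← Finset.mul_sum, Finset.prod_range_succ]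
      change _ = _ * (moveTail (T s) s).mulVec w x
      linear_combination (tailDet φ s x * (∏ t ∈ range s, c t x) * c s x *
        (moveTail (T s) s).mulVec w x) * ordInd_zero_mul (R := R) s x
    rw [Finset.sum_congr rfl fun x _ => h1 x, Finset.sum_comm]
    refine Finset.sum_congr rfl fun y _ => ?_
    by_cases hy : w y = 0
    · simp [hy]
    obtain ⟨z, -, hz⟩ := Finset.exists_ne_zero_of_sum_ne_zero hy
    have htail := forall_of_frozenTransfer_ne_zero (left_ne_zero_of_mul hz)
    have hs : s + 1 < N := by omega
    rw [← moveTail_vecMul_tailDet (hφ s hs), Matrix.vecMul, dotProduct, Finset.sum_mul,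
      Finset.sum_mul, Finset.sum_mul]
    refine Finset.sum_congr rfl fun x _ => ?_
    by_cases hxy : moveTail (T s) s x y = 0
    · simp [hxy]
    have hprod : ∏ t ∈ range (s + 1), c t x = ∏ t ∈ range (s + 1), c t y :=
      Finset.prod_congr rfl fun t ht => hc t x y fun j hj =>
        eq_of_moveTail_ne_zero hxy (by have := Finset.mem_range.1 ht; omega)
    have hle := le_of_moveTail_ne_zero (hT s) hxy
    have hfro : ∀ j : Fin N, (j : ℕ) ≤ s → x j = y j := fun j hj =>
      eq_of_moveTail_ne_zero hxy hj
    suffices h : tailDet φ s x * (ordInd 0 x : R) = tailDet φ s x * ordInd 0 y by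
      rw [hprod, h]; ring
    by_cases hyo : ∀ i j : Fin N, 0 ≤ (i : ℕ) → i < j → y j < y i
    · -- a weakly decreasing `x` is either strictly decreasing or has a collision at level `s`
      by_cases hxo : ∀ i j : Fin N, 0 ≤ (i : ℕ) → i < j → x j < x i
      · rw [ordInd_of_forall hxo, ordInd_of_forall hyo]
      push Not at hxo
      obtain ⟨i, j, -, hij, hxij⟩ := hxo
      have hyij := hyo i j (Nat.zero_le _) hij
      have hlej := (hle j).2
      have hlei := (hle i).1
      have heq : x i = x j := by
        rw [Fin.le_def] at hxij hlei
        rw [Fin.lt_def] at hyij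
        rw [Fin.ext_iff]
        omega
      rw [tailDet_eq_zero hij ?_ heq, zero_mul, zero_mul]
      by_contra hi
      rw [hfro i (by omega)] at heq
      by_cases hj : (j : ℕ) ≤ s
      · rw [hfro j hj] at heq
        exact hyij.ne heq.symm
      · have h3 := hyo i ⟨s, by omega⟩ (Nat.zero_le _) (by rw [Fin.lt_def]; simp only; omega)
        have h4 := hyo ⟨s, by omega⟩ j (Nat.zero_le _) (by rw [Fin.lt_def]; simp only; omega)
        rw [Fin.lt_def] at h3 h4
        rw [Fin.ext_iff] at heq
        omega
    · by_cases hxo : ∀ i j : Fin N, 0 ≤ (i : ℕ) → i < j → x j < x i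
      · refine absurd ?_ hyo
        intro i j _ hij
        by_cases hi : (i : ℕ) ≤ s
        · rw [← hfro i hi]
          exact (hle j).1.trans_lt (hxo i j (Nat.zero_le _) hij)
        · exact htail i j (by omega) hij
      · rw [ordInd_of_not hxo, ordInd_of_not hyo]

/-- The sum over nonintersecting paths with weights that depend on the diagonal points only is the
sum over the diagonal of the product of two determinants. -/
theorem sum_det_mul_pathSum (hN : 0 < N) (hc : DiagonalWeights c) (hT : ∀ s, IsDescending (T s))
    {φ ψ : ℕ → Fin N → Fin M → R}
    (hφ : ∀ s, s + 1 < N → ∀ i, φ (s + 1) i = (T s).vecMul (φ s i))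
    (hψ : ∀ s, s + 1 < N → ∀ i, ψ s i = (T s).mulVec (ψ (s + 1) i)) :
    ∑ x : Fin N → Fin M, (Matrix.of fun i j => φ 0 i (x j)).det *
        pathSum T c (fun x => (Matrix.of fun i j => ψ (N - 1) i (x j)).det) (N - 1) 0 x =
      ∑ x : Fin N → Fin M, ordInd 0 x * (∏ t ∈ range N, c t x) *
        ((Matrix.of fun i j : Fin N => φ j i (x j)).det *
          (Matrix.of fun i j : Fin N => ψ j i (x j)).det) := by
  have h0 : (fun x : Fin N → Fin M => (Matrix.of fun i j => ψ (N - 1) i (x j)).det) =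
      headDet ψ (0 + (N - 1)) := by
    funext x
    unfold headDet
    congr 2
    funext i j
    rw [max_eq_right (by omega), Nat.zero_add]
  rw [h0, pathSum_eq_frozenTransfer hc hT hψ (N - 1) 0 (by omega)]
  have h1 := sum_tailDet_mul_frozenTransfer hc hT hφ (headDet ψ 0) (N - 1) 0 (by omega)
  rw [show 0 + (N - 1) + 1 = N by omega] at h1
  refine Eq.trans (Eq.trans (Finset.sum_congr rfl fun x _ => ?_) h1)
    (Finset.sum_congr rfl fun x _ => ?_)
  · simp only [tailDet, Nat.min_zero, Finset.range_zero, Finset.prod_empty, mul_one]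
    ring
  · have h2 : tailDet φ (0 + (N - 1)) x = (Matrix.of fun i j : Fin N => φ j i (x j)).det := by
      unfold tailDet
      congr 2
      funext i j
      rw [min_eq_left (by omega)]
    simp only [h2, headDet, Nat.max_zero]
    ring

end Paths

/-! ### Extraction of the coefficient -/

theorem card_filter_lt_val {N : ℕ} (l : Fin N) :
    (univ.filter fun j : Fin N => l < j).card = N - ((l : ℕ) + 1) := by
  rw [show (univ.filter fun j : Fin N => l < j) = Finset.Ioi l by ext; simp, Fin.card_Ioi]
  omega

/-- In a strictly decreasing tuple of length `N`, the entry with index `l` equals `a` if and only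
if `N - (l + 1)` entries are less than `a`, and one entry equals `a`. -/
theorem apply_eq_iff_card {N : ℕ} {x : Fin N → ℕ} (hx : StrictAnti x) (l : Fin N) (a : ℕ) :
    x l = a ↔ (univ.filter fun j => x j < a).card = N - ((l : ℕ) + 1) ∧
      (univ.filter fun j => x j = a).card = 1 := by
  have key : ∀ m : Fin N, x m = a → (univ.filter fun j => x j < a).card = N - ((m : ℕ) + 1) := by
    rintro m rfl
    simp only [hx.lt_iff_gt]
    exact card_filter_lt_val m
  constructor
  · intro h
    refine ⟨key l h, Finset.card_eq_one.2 ⟨l, ?_⟩⟩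
    ext j
    simp only [mem_filter, mem_univ, true_and, mem_singleton]
    exact ⟨fun hj => hx.injective (hj.trans h.symm), fun hj => hj ▸ h⟩
  · rintro ⟨h1, h2⟩
    obtain ⟨m, hm⟩ := Finset.card_eq_one.1 h2
    have hm' : x m = a := by
      have : m ∈ univ.filter fun j => x j = a := by rw [hm]; exact mem_singleton_self m
      exact (mem_filter.1 this).2
    have h3 := key m hm'
    rw [h1] at h3
    have : l = m := Fin.ext (by omega)
    rw [this, hm']

section Coefficient

variable {N M k : ℕ} {i : Fin k → Fin N} {a : Fin k → ℕ}

/-- The exponent of the monomial by which a point `x` at level `s` is weighted: `z_p` if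
`x < a p`, and `w_p` if `x = a p`, where `s` is the level `i p`. -/
def pointExponent (i : Fin k → Fin N) (a : Fin k → ℕ) (s x : ℕ) : (Fin k ⊕ Fin k) →₀ ℕ :=
  Finsupp.equivFunOnFinite.symm (Sum.elim
    (fun p => if (i p : ℕ) = s ∧ x < a p then 1 else 0)
    (fun p => if (i p : ℕ) = s ∧ x = a p then 1 else 0))

/-- The part of the target exponent that involves the levels from `s` on. -/
def tailExponent (i : Fin k → Fin N) (s : ℕ) : (Fin k ⊕ Fin k) →₀ ℕ :=
  Finsupp.equivFunOnFinite.symm (Sum.elim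
    (fun p => if s ≤ (i p : ℕ) then N - ((i p : ℕ) + 1) else 0)
    (fun p => if s ≤ (i p : ℕ) then 1 else 0))

/-- The indicator that a configuration at level `s = i p` has its diagonal point at `a p`. -/
def diagWeight (i : Fin k → Fin N) (a : Fin k → ℕ) (s : ℕ) (x : Fin N → Fin M) : ℂ :=
  if ∀ p, (i p : ℕ) = s → (x (i p) : ℕ) = a p then 1 else 0

theorem diagonalWeights_diagWeight : DiagonalWeights (diagWeight (M := M) i a) := by
  intro s x y h
  unfold diagWeight
  congr 1
  refine propext (forall_congr' fun p => forall_congr' fun hp => ?_)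
  rw [h (i p) hp]

theorem tailExponent_zero (i : Fin k → Fin N) : tailExponent i 0 = targetExponent i := by
  unfold tailExponent targetExponent
  simp

theorem tailExponent_last (i : Fin k → Fin N) : tailExponent i N = 0 := by
  ext (p | p) <;> simp [tailExponent]

/-- The polynomial involves only the variables of the levels from `s` on. -/
def InvolvesFrom (i : Fin k → Fin N) (s : ℕ) (q : MvPolynomial (Fin k ⊕ Fin k) ℂ) : Prop :=
  ∀ d, q.coeff d ≠ 0 → ∀ p, (i p : ℕ) < s → d (Sum.inl p) = 0 ∧ d (Sum.inr p) = 0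

theorem sum_pointExponent_inl (s : ℕ) (x : Fin N → Fin M) (p : Fin k) :
    (∑ l, pointExponent i a s (x l)) (Sum.inl p) =
      if (i p : ℕ) = s then (univ.filter fun l => (x l : ℕ) < a p).card else 0 := by
  rw [Finsupp.finsetSum_apply]
  by_cases h : (i p : ℕ) = s <;> simp [pointExponent, h]

theorem sum_pointExponent_inr (s : ℕ) (x : Fin N → Fin M) (p : Fin k) :
    (∑ l, pointExponent i a s (x l)) (Sum.inr p) =
      if (i p : ℕ) = s then (univ.filter fun l => (x l : ℕ) = a p).card else 0 := by
  rw [Finsupp.finsetSum_apply]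
  by_cases h : (i p : ℕ) = s <;> simp [pointExponent, h]

theorem involvesFrom_monomial_mul {s : ℕ} (x : Fin N → Fin M)
    {q : MvPolynomial (Fin k ⊕ Fin k) ℂ} (hq : InvolvesFrom i (s + 1) q) :
    InvolvesFrom i s (MvPolynomial.monomial (∑ l, pointExponent i a s (x l)) 1 * q) := by
  intro d hd p hp
  rw [MvPolynomial.coeff_monomial_mul', one_mul] at hd
  split_ifs at hd with hle
  swap
  · exact absurd rfl hd
  have h1 := hq _ hd p (by omega)
  rw [Finsupp.tsub_apply, Finsupp.tsub_apply, sum_pointExponent_inl, sum_pointExponent_inr,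
    if_neg (by omega), if_neg (by omega)] at h1
  exact h1

/-- Since the later levels do not involve the variables of level `s`, the coefficient of the target
monomial pins the numbers of points below `a p` and at `a p` on level `s = i p`, that is, the
position of the diagonal point. -/
theorem coeff_monomial_mul_eq_diagWeight {s : ℕ} {x : Fin N → Fin M} (hx : StrictAnti x)
    {q : MvPolynomial (Fin k ⊕ Fin k) ℂ} (hq : InvolvesFrom i (s + 1) q) :
    MvPolynomial.coeff (tailExponent i s)
        (MvPolynomial.monomial (∑ l, pointExponent i a s (x l)) 1 * q) =
      diagWeight i a s x * q.coeff (tailExponent i (s + 1)) := by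
  have hx' : StrictAnti fun l => (x l : ℕ) := fun l m h => hx h
  by_cases hc : ∀ p, (i p : ℕ) = s → (x (i p) : ℕ) = a p
  · rw [diagWeight, if_pos hc, one_mul]
    have : tailExponent i s = ∑ l, pointExponent i a s (x l) + tailExponent i (s + 1) := by
      ext (p | p)
      · rw [Finsupp.add_apply, sum_pointExponent_inl]
        by_cases hp : (i p : ℕ) = s
        · rw [if_pos hp, ((apply_eq_iff_card hx' (i p) (a p)).1 (hc p hp)).1]
          simp [tailExponent, hp]
        · simp only [tailExponent, Finsupp.equivFunOnFinite_symm_apply_apply, Sum.elim_inl,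
            if_neg hp, zero_add]
          congr 1
          exact propext (by omega)
      · rw [Finsupp.add_apply, sum_pointExponent_inr]
        by_cases hp : (i p : ℕ) = s
        · rw [if_pos hp, ((apply_eq_iff_card hx' (i p) (a p)).1 (hc p hp)).2]
          simp [tailExponent, hp]
        · simp only [tailExponent, Finsupp.equivFunOnFinite_symm_apply_apply, Sum.elim_inr,
            if_neg hp, zero_add]
          congr 1
          exact propext (by omega)
    rw [this, MvPolynomial.coeff_monomial_mul, one_mul]
  · rw [diagWeight, if_neg hc, zero_mul, MvPolynomial.coeff_monomial_mul', one_mul]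
    split_ifs with hle
    swap
    · rfl
    by_contra hne
    push Not at hc
    obtain ⟨p, hp, hxp⟩ := hc
    have h1 := hq _ hne p (by omega)
    have hl := hle (Sum.inl p)
    have hr := hle (Sum.inr p)
    rw [Finsupp.tsub_apply, Finsupp.tsub_apply] at h1
    rw [sum_pointExponent_inl, if_pos hp] at hl h1
    rw [sum_pointExponent_inr, if_pos hp] at hr h1
    simp only [tailExponent, Finsupp.equivFunOnFinite_symm_apply_apply, Sum.elim_inl,
      Sum.elim_inr, if_pos hp.ge] at hl hr h1
    exact hxp ((apply_eq_iff_card hx' (i p) (a p)).2 ⟨by omega, by omega⟩)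

theorem InvolvesFrom.sum {ι : Type*} (S : Finset ι) {s : ℕ}
    {q : ι → MvPolynomial (Fin k ⊕ Fin k) ℂ} (hq : ∀ y ∈ S, InvolvesFrom i s (q y)) :
    InvolvesFrom i s (∑ y ∈ S, q y) := by
  intro d hd
  rw [MvPolynomial.coeff_sum] at hd
  obtain ⟨y, hy, hne⟩ := Finset.exists_ne_zero_of_sum_ne_zero hd
  exact hq y hy d hne

theorem InvolvesFrom.C_mul {s : ℕ} {q : MvPolynomial (Fin k ⊕ Fin k) ℂ}
    (hq : InvolvesFrom i s q) (b : ℂ) : InvolvesFrom i s (MvPolynomial.C b * q) := by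
  intro d hd
  rw [MvPolynomial.coeff_C_mul] at hd
  exact hq d (right_ne_zero_of_mul hd)

theorem InvolvesFrom.C (s : ℕ) (b : ℂ) : InvolvesFrom i s (MvPolynomial.C b) := by
  intro d hd p _
  rw [MvPolynomial.coeff_C] at hd
  split_ifs at hd with h
  · subst h; simp
  · exact absurd rfl hd

/-- The functions `g_s T_s g_{s+1} T_{s+1} ⋯ g_{s+n} f` at level `s`, where `g_t` multiplies by the
monomial that weights the points at level `t`. -/
def weightedChain (i : Fin k → Fin N) (a : Fin k → ℕ) (T : ℕ → Matrix (Fin M) (Fin M) ℂ)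
    (f : Fin M → ℂ) : ℕ → ℕ → Fin M → MvPolynomial (Fin k ⊕ Fin k) ℂ
  | 0, s => fun x => MvPolynomial.monomial (pointExponent i a s x) 1 * MvPolynomial.C (f x)
  | n + 1, s => fun x => MvPolynomial.monomial (pointExponent i a s x) 1 *
      ((T s).map MvPolynomial.C).mulVec (weightedChain i a T f n (s + 1)) x

theorem det_monomial_mul (s : ℕ) (x : Fin N → Fin M)
    (A : Fin N → Fin N → MvPolynomial (Fin k ⊕ Fin k) ℂ) :
    (Matrix.of fun j l => MvPolynomial.monomial (pointExponent i a s (x l)) 1 * A j l).det =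
      MvPolynomial.monomial (∑ l, pointExponent i a s (x l)) 1 * (Matrix.of A).det := by
  rw [MvPolynomial.monomial_sum_one]
  exact Matrix.det_mul_row (fun l => MvPolynomial.monomial (pointExponent i a s (x l)) 1)
    (Matrix.of A)

theorem det_weightedChain_zero (T : ℕ → Matrix (Fin M) (Fin M) ℂ) (ψ : Fin N → Fin M → ℂ) (s : ℕ)
    (x : Fin N → Fin M) :
    (Matrix.of fun j l => weightedChain i a T (ψ j) 0 s (x l)).det =
      MvPolynomial.monomial (∑ l, pointExponent i a s (x l)) 1 *
        MvPolynomial.C (Matrix.of fun j l => ψ j (x l)).det := by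
  rw [RingHom.map_det]
  exact det_monomial_mul s x fun j l => MvPolynomial.C (ψ j (x l))

theorem det_weightedChain_succ (T : ℕ → Matrix (Fin M) (Fin M) ℂ) (ψ : Fin N → Fin M → ℂ)
    (n s : ℕ) (x : Fin N → Fin M) :
    (Matrix.of fun j l => weightedChain i a T (ψ j) (n + 1) s (x l)).det =
      MvPolynomial.monomial (∑ l, pointExponent i a s (x l)) 1 *
        ∑ y : Fin N → Fin M, MvPolynomial.C (tens (fun _ => T s) x y) *
          (Matrix.of fun j l => weightedChain i a T (ψ j) n (s + 1) (y l)).det := by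
  refine (det_monomial_mul s x fun j l => ((T s).map MvPolynomial.C).mulVec
    (weightedChain i a T (ψ j) n (s + 1)) (x l)).trans ?_
  congr 1
  have := congrFun (tens_mulVec_det (fun _ : Fin N => (T s).map MvPolynomial.C)
    fun j _ => weightedChain i a T (ψ j) n (s + 1)) x
  rw [← this]
  refine Finset.sum_congr rfl fun y _ => ?_
  simp only [tens, Matrix.of_apply, Matrix.map_apply, map_prod]

theorem involvesFrom_det_weightedChain (T : ℕ → Matrix (Fin M) (Fin M) ℂ) (ψ : Fin N → Fin M → ℂ)
    (n s : ℕ) (x : Fin N → Fin M) :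
    InvolvesFrom i s (Matrix.of fun j l => weightedChain i a T (ψ j) n s (x l)).det := by
  induction n generalizing s x with
  | zero =>
    rw [det_weightedChain_zero]
    exact involvesFrom_monomial_mul x (InvolvesFrom.C _ _)
  | succ n ih =>
    rw [det_weightedChain_succ]
    exact involvesFrom_monomial_mul x (InvolvesFrom.sum _ fun y _ => (ih _ _).C_mul _)

theorem pathSum_eq_zero {T : ℕ → Matrix (Fin M) (Fin M) ℂ} {c : ℕ → (Fin N → Fin M) → ℂ}
    {v : (Fin N → Fin M) → ℂ} (n s : ℕ) {x : Fin N → Fin M} (hx : ¬ StrictAnti x) :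
    pathSum T c v n s x = 0 := by
  classical
  have h : (ordInd 0 x : ℂ) = 0 := by rw [ordInd_zero_eq_ite, if_neg hx]
  cases n <;> exact mul_eq_zero_of_left h _

/-- The coefficient of the target monomial in the generating function of the nonintersecting paths
is the sum over the paths with prescribed diagonal points. -/
theorem coeff_det_weightedChain {T : ℕ → Matrix (Fin M) (Fin M) ℂ} (hT : ∀ s, IsDescending (T s))
    (ψ : Fin N → Fin M → ℂ) (n s : ℕ) (hs : s + n + 1 = N) (x : Fin N → Fin M) (hx : Antitone x) :
    MvPolynomial.coeff (tailExponent i s)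
        (Matrix.of fun j l => weightedChain i a T (ψ j) n s (x l)).det =
      pathSum T (diagWeight i a) (fun x => (Matrix.of fun j l => ψ j (x l)).det) n s x := by
  classical
  induction n generalizing s x with
  | zero =>
    by_cases hx' : StrictAnti x
    · rw [det_weightedChain_zero, coeff_monomial_mul_eq_diagWeight hx' (InvolvesFrom.C _ _),
        show s + 1 = N from hs, tailExponent_last, MvPolynomial.coeff_C, if_pos rfl]
      simp only [pathSum, ordInd_zero_eq_ite, if_pos hx', one_mul]
    · rw [pathSum_eq_zero _ _ hx']
      have hinj : ¬ Function.Injective x := fun h => hx' (hx.strictAnti_of_injective h)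
      simp only [Function.Injective, not_forall] at hinj
      obtain ⟨l, m, hlm, hne⟩ := hinj
      rw [det_columns_eq_zero (fun j _ => weightedChain i a T (ψ j) 0 s) x hne hlm fun _ => rfl,
        MvPolynomial.coeff_zero]
  | succ n ih =>
    by_cases hx' : StrictAnti x
    swap
    · rw [pathSum_eq_zero _ _ hx']
      have hinj : ¬ Function.Injective x := fun h => hx' (hx.strictAnti_of_injective h)
      simp only [Function.Injective, not_forall] at hinj
      obtain ⟨l, m, hlm, hne⟩ := hinj
      rw [det_columns_eq_zero (fun j _ => weightedChain i a T (ψ j) (n + 1) s) x hne hlm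
        fun _ => rfl, MvPolynomial.coeff_zero]
    rw [det_weightedChain_succ, coeff_monomial_mul_eq_diagWeight hx'
      (InvolvesFrom.sum _ fun y _ => (involvesFrom_det_weightedChain _ _ _ _ _).C_mul _),
      MvPolynomial.coeff_sum]
    change _ = ordInd 0 x * (_ * ∑ y, tens (fun _ => T s) x y * pathSum T _ _ n (s + 1) y)
    rw [ordInd_zero_eq_ite, if_pos hx', one_mul]
    congr 1
    refine Finset.sum_congr rfl fun y _ => ?_
    rw [MvPolynomial.coeff_C_mul]
    by_cases hxy : tens (fun _ : Fin N => T s) x y = 0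
    · rw [hxy, zero_mul, zero_mul]
    congr 1
    refine ih (s + 1) (by omega) y fun l m hlm => ?_
    rcases hlm.eq_or_lt with rfl | hlt
    · exact le_rfl
    have h1 := (hT s _ _ (tens_ne_zero hxy l)).2
    have h2 := (hT s _ _ (tens_ne_zero hxy m)).1
    have h3 := hx' hlt
    rw [Fin.le_def] at h2 ⊢
    rw [Fin.lt_def] at h3
    omega

theorem prod_diagWeight (x : Fin N → Fin M) :
    ∏ t ∈ range N, diagWeight i a t x = if ∀ p, (x (i p) : ℕ) = a p then 1 else 0 := by
  unfold diagWeight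
  rw [Finset.prod_ite_zero, Finset.prod_const_one]
  congr 1
  refine propext ⟨fun h p => h (i p) (mem_range.2 (i p).2) p rfl, fun h s _ p _ => h p⟩

/-- The coefficient of the target monomial in the generating function of the nonintersecting path
ensemble is the sum over the diagonal configurations with the prescribed points. -/
theorem coeff_det_pairing (hN : 0 < N) {T : ℕ → Matrix (Fin M) (Fin M) ℂ}
    (hT : ∀ s, IsDescending (T s)) {φ ψ : ℕ → Fin N → Fin M → ℂ}
    (hφ : ∀ s, s + 1 < N → ∀ i, φ (s + 1) i = (T s).vecMul (φ s i))
    (hψ : ∀ s, s + 1 < N → ∀ i, ψ s i = (T s).mulVec (ψ (s + 1) i))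
    [DecidablePred fun x : Fin N → Fin M => StrictAnti x ∧ ∀ p, (x (i p) : ℕ) = a p] :
    MvPolynomial.coeff (targetExponent i)
        (Matrix.of fun j l => ∑ x, MvPolynomial.C (φ 0 j x) *
          weightedChain i a T (ψ (N - 1) l) (N - 1) 0 x).det =
      ∑ x ∈ univ.filter fun x : Fin N → Fin M => StrictAnti x ∧ ∀ p, (x (i p) : ℕ) = a p,
        (Matrix.of fun i j : Fin N => φ j i (x j)).det *
          (Matrix.of fun i j : Fin N => ψ j i (x j)).det := by
  classical
  rw [det_mul_eq_sum_strictAnti (fun j x => MvPolynomial.C (φ 0 j x))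
    fun l x => weightedChain i a T (ψ (N - 1) l) (N - 1) 0 x, MvPolynomial.coeff_sum]
  have h := sum_det_mul_pathSum hN (diagonalWeights_diagWeight (i := i) (a := a)) hT hφ hψ
  have h1 : ∀ x : Fin N → Fin M, ordInd 0 x * (∏ t ∈ range N, diagWeight i a t x) *
      ((Matrix.of fun i j : Fin N => φ j i (x j)).det *
          (Matrix.of fun i j : Fin N => ψ j i (x j)).det) =
      if StrictAnti x ∧ ∀ p, (x (i p) : ℕ) = a p then
        (Matrix.of fun i j : Fin N => φ j i (x j)).det *
          (Matrix.of fun i j : Fin N => ψ j i (x j)).det else 0 := fun x => by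
    rw [prod_diagWeight, ordInd_zero_eq_ite]
    by_cases h1 : StrictAnti x <;> by_cases h2 : ∀ p, (x (i p) : ℕ) = a p <;> simp [h1, h2]
  rw [Finset.sum_filter, Finset.sum_filter, ← Finset.sum_congr rfl fun x _ => h1 x, ← h]
  refine Finset.sum_congr rfl fun x _ => ?_
  by_cases hx : StrictAnti x
  · rw [if_pos hx, ← coeff_det_weightedChain hT _ (N - 1) 0 (by omega) x hx.antitone,
      tailExponent_zero, ← MvPolynomial.coeff_C_mul, RingHom.map_det]
    rfl
  · rw [if_neg hx, pathSum_eq_zero _ _ hx, mul_zero]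

end Coefficient

/-! ### The Fredholm determinant -/

/-- A matrix `A` that strictly raises the level is block triangular with zero diagonal blocks. -/
theorem det_one_sub_eq_one {V R : Type*} [Fintype V] [DecidableEq V] [CommRing R] {n : ℕ}
    (level : V → Fin n) {A : Matrix V V R} (hA : ∀ u v, A u v ≠ 0 → level u < level v) :
    (1 - A).det = 1 := by
  have h0 : ∀ u v, level v ≤ level u → A u v = 0 := fun u v h => by
    by_contra hne
    exact absurd (hA u v hne) (not_lt.2 h)
  have hB : (1 - A).BlockTriangular level := by
    intro u v huv
    have hne : u ≠ v := fun h => by subst h; exact lt_irrefl _ huv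
    rw [Matrix.sub_apply, Matrix.one_apply_ne hne, h0 u v huv.le, sub_zero]
  rw [hB.det_fintype]
  refine Finset.prod_eq_one fun l _ => ?_
  rw [show (1 - A).toSquareBlock level l = 1 from ?_, Matrix.det_one]
  ext u v
  rw [Matrix.toSquareBlock_def, Matrix.of_apply, Matrix.sub_apply,
    h0 u v (by rw [u.2, v.2]), sub_zero, Matrix.one_apply, Matrix.one_apply]
  simp only [Subtype.ext_iff]

/-- The Eynard–Mehta theorem in generating function form. The matrix `D` is the transfer operator
between successive levels, `U = (1 - D)⁻¹` sums over paths, and `g` weights the points, so that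
`Ξ = (1 - g D)⁻¹ g b` carries the weights of a path from each point to the end. -/
theorem det_weighted_eq_det_mul_fredholm {ι V R : Type*} [Fintype ι] [DecidableEq ι] [Fintype V]
    [DecidableEq V] [CommRing R] {a : Matrix ι V R} {b Ξ : Matrix V ι R} {D U g : Matrix V V R}
    {Γ : Matrix ι ι R} (hU : (1 - D) * U = 1) (hD : (1 - D).det = 1) (hgD : (1 - g * D).det = 1)
    (hΓ : (a * U * b) * Γ = 1) (hΞ : (1 - g * D) * Ξ = g * b) :
    (a * Ξ).det =
      (a * U * b).det * (1 - (1 - g) * (U * b * Γ * (a * U) - (U - 1))).det := by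
  -- `Q = 1 + (1 - g) (U - 1)` is unimodular, and its inverse solves the equation for `Ξ`
  set Q := (1 - g * D) * U with hQ
  have hUD : U * (1 - D) = 1 := mul_eq_one_comm.1 hU
  have hDU : D * U = U - 1 := by
    have : U - D * U = 1 := by rw [← hU, sub_mul, one_mul]
    rw [← this]; abel
  have hQ' : Q = 1 + (1 - g) * (U - 1) := by
    rw [hQ, sub_mul, one_mul, mul_assoc, hDU]; noncomm_ring
  have hdetU : U.det = 1 := by
    have := congrArg Matrix.det hU
    rwa [Matrix.det_mul, hD, one_mul, Matrix.det_one] at this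
  have hQdet : Q.det = 1 := by rw [hQ, Matrix.det_mul, hgD, hdetU, one_mul]
  have hQinv : Q⁻¹ * Q = 1 := Matrix.nonsing_inv_mul _ (by rw [hQdet]; exact isUnit_one)
  have hQidet : (Q⁻¹).det = 1 := by
    have := congrArg Matrix.det hQinv
    rwa [Matrix.det_mul, hQdet, mul_one, Matrix.det_one] at this
  have h1 : Q * (b - (1 - D) * Ξ) = (1 - g) * (U * b) := by
    have h2 : Q * ((1 - D) * Ξ) = g * b := by
      rw [← hΞ, hQ, ← Matrix.mul_assoc, Matrix.mul_assoc _ U, hUD, Matrix.mul_one]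
    rw [Matrix.mul_sub, h2, hQ', Matrix.add_mul, Matrix.one_mul, Matrix.mul_assoc,
      Matrix.sub_mul U, Matrix.one_mul, Matrix.mul_sub, Matrix.sub_mul 1 g b, Matrix.one_mul]
    abel
  have h3 : b - (1 - D) * Ξ = Q⁻¹ * ((1 - g) * (U * b)) := by
    rw [← h1, ← Matrix.mul_assoc, hQinv, Matrix.one_mul]
  have h4 : a * Ξ = (a * U * b) * (1 - Γ * (a * U) * (Q⁻¹ * ((1 - g) * (U * b)))) := by
    have h5 : a * U * ((1 - D) * Ξ) = a * Ξ := by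
      rw [Matrix.mul_assoc, ← Matrix.mul_assoc U, hUD, Matrix.one_mul]
    rw [← h3, Matrix.mul_sub, Matrix.mul_one, ← Matrix.mul_assoc, ← Matrix.mul_assoc, hΓ,
      Matrix.one_mul, Matrix.mul_sub, h5]
    abel
  rw [h4, Matrix.det_mul, Matrix.det_one_sub_mul_comm]
  congr 1
  have h6 : Q⁻¹ * (1 - (1 - g) * (U * b * Γ * (a * U) - (U - 1))) =
      1 - Q⁻¹ * ((1 - g) * (U * b)) * (Γ * (a * U)) := by
    have : 1 - (1 - g) * (U * b * Γ * (a * U) - (U - 1)) =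
        Q - (1 - g) * (U * b * Γ * (a * U)) := by
      rw [hQ']; noncomm_ring
    rw [this, Matrix.mul_sub, hQinv]
    simp only [Matrix.mul_assoc]
  rw [← h6, Matrix.det_mul, hQidet, one_mul]

/-! ### Difference operators and transition matrices -/

/-- The function `f` cut off to `{0, …, M - 1}`. -/
def trunc (M : ℕ) (f : ℕ → ℂ) : ℕ → ℂ := fun k => if k < M then f k else 0

theorem trunc_of_lt {M k : ℕ} (f : ℕ → ℂ) (h : k < M) : trunc M f k = f k := if_pos h

theorem trunc_of_le {M k : ℕ} (f : ℕ → ℂ) (h : M ≤ k) : trunc M f k = 0 := if_neg (not_lt.2 h)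

/-- The matrix of `T_b` on `{0, …, M - 1}`. -/
def transMat (M : ℕ) (b : ℂ) : Matrix (Fin M) (Fin M) ℂ :=
  Matrix.of fun x y => transition b x y

theorem isDescending_transMat (M : ℕ) (b : ℂ) : IsDescending (transMat M b) := by
  intro x y h
  simp only [transMat, Matrix.of_apply, transition] at h
  rw [Fin.le_def]
  by_contra hn
  rw [if_neg (by omega), if_neg (by omega)] at h
  simp at h

theorem diffOp_comm (b c : ℂ) (f : ℕ → ℂ) : diffOp b (diffOp c f) = diffOp c (diffOp b f) := by
  funext k
  simp only [diffOp]
  ring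

theorem diffChain_self (β : ℕ → ℂ) (a : ℕ) (f : ℕ → ℂ) : diffChain β a a f = f := by
  simp [diffChain]

theorem diffChain_succ (β : ℕ → ℂ) {a b : ℕ} (h : a ≤ b) (f : ℕ → ℂ) :
    diffChain β a (b + 1) f = diffOp (β b) (diffChain β a b f) := by
  have hcomm : ∀ (l : List ℕ) (c : ℂ) (f : ℕ → ℂ),
      l.foldr (fun r g => diffOp (β r) g) (diffOp c f) =
        diffOp c (l.foldr (fun r g => diffOp (β r) g) f) := by
    intro l c f
    induction l with
    | nil => rfl
    | cons r l ih => rw [List.foldr_cons, ih, diffOp_comm, List.foldr_cons]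
  unfold diffChain
  rw [List.Ico.succ_top h, List.foldr_append]
  exact hcomm _ _ _

theorem diffChainDagger_self (β : ℕ → ℂ) (a : ℕ) (f : ℕ → ℂ) : diffChainDagger β a a f = f := by
  simp [diffChainDagger]

theorem diffChainDagger_eq (β : ℕ → ℂ) {a b : ℕ} (h : a < b) (f : ℕ → ℂ) :
    diffChainDagger β a b f = diffOpDagger (β a) (diffChainDagger β (a + 1) b f) := by
  unfold diffChainDagger
  rw [List.Ico.eq_cons h, List.foldr_cons]

/-- `D^{[a,b)} f` at `k` depends only on the values of `f` on `{k, …, k + (b - a)}`. -/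
theorem diffChain_congr (β : ℕ → ℂ) {a b : ℕ} (h : a ≤ b) {f f' : ℕ → ℂ} {k : ℕ}
    (hf : ∀ m, k ≤ m → m ≤ k + (b - a) → f m = f' m) :
    diffChain β a b f k = diffChain β a b f' k := by
  induction b, h using Nat.le_induction generalizing k with
  | base =>
    rw [diffChain_self, diffChain_self]
    exact hf k le_rfl (by omega)
  | succ b hb ih =>
    rw [diffChain_succ β hb, diffChain_succ β hb]
    simp only [diffOp]
    rw [ih fun m h1 h2 => hf m h1 (by omega), ih fun m h1 h2 => hf m (by omega) (by omega)]

theorem diffChain_zero (β : ℕ → ℂ) {a b : ℕ} (h : a ≤ b) : diffChain β a b (fun _ => 0) = 0 := by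
  induction b, h using Nat.le_induction with
  | base => rw [diffChain_self]; rfl
  | succ b hb ih => rw [diffChain_succ β hb, ih]; funext k; simp [diffOp]

theorem diffChain_trunc_of_le (β : ℕ → ℂ) {a b : ℕ} (h : a ≤ b) {M k : ℕ} (f : ℕ → ℂ)
    (hk : M ≤ k) : diffChain β a b (trunc M f) k = 0 := by
  rw [diffChain_congr β h (f' := fun _ => 0) fun m h1 _ => trunc_of_le f (hk.trans h1),
    diffChain_zero β h, Pi.zero_apply]

theorem vecMul_transMat {M : ℕ} (b : ℂ) {f : ℕ → ℂ} (hf : f M = 0) :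
    (transMat M b).vecMul (fun x : Fin M => f x) = fun y : Fin M => diffOp b f y := by
  funext y
  simp only [Matrix.vecMul, dotProduct, transMat, Matrix.of_apply, transition, diffOp, mul_sub,
    Finset.sum_sub_distrib]
  congr 1
  · rw [Finset.sum_eq_single y]
    · simp
    · intro x _ hx
      rw [if_neg fun h => hx (Fin.ext h.symm), mul_zero]
    · simp
  · by_cases hy : (y : ℕ) + 1 < M
    · rw [Finset.sum_eq_single ⟨y + 1, hy⟩]
      · simp [mul_comm]
      · intro x _ hx
        rw [if_neg fun h => hx (Fin.ext h.symm), mul_zero, mul_zero]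
      · simp
    · rw [show (y : ℕ) + 1 = M by omega, hf, mul_zero]
      refine Finset.sum_eq_zero fun x _ => ?_
      rw [if_neg (by omega), mul_zero, mul_zero]

theorem transMat_mulVec {M : ℕ} (b : ℂ) (f : ℕ → ℂ) :
    (transMat M b).mulVec (fun x : Fin M => f x) = fun x : Fin M => diffOpDagger b f x := by
  funext x
  simp only [Matrix.mulVec, dotProduct, transMat, Matrix.of_apply, transition, diffOpDagger,
    sub_mul, Finset.sum_sub_distrib]
  congr 1
  · rw [Finset.sum_eq_single x]
    · simp
    · intro y _ hy
      rw [if_neg fun h => hy (Fin.ext h), zero_mul]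
    · simp
  · by_cases hx : 1 ≤ (x : ℕ)
    · rw [Finset.sum_eq_single ⟨x - 1, by omega⟩]
      · rw [if_pos hx, if_pos (Nat.sub_add_cancel hx), mul_one]
      · intro y _ hy
        rw [if_neg fun h => hy (Fin.ext (by simp only; omega)), mul_zero, zero_mul]
      · simp
    · rw [if_neg hx, mul_zero]
      refine Finset.sum_eq_zero fun y _ => ?_
      rw [if_neg (by omega), mul_zero, zero_mul]

theorem conv_transition (b : ℂ) (g : ℕ → ℕ → ℂ) (x y : ℕ) :
    conv (transition b) g x y = diffOpDagger b (fun z => g z y) x := by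
  unfold conv
  rw [tsum_eq_sum (s := Finset.range (x + 1))]
  · have := congrFun (transMat_mulVec (M := x + 1) b fun z => g z y) (Fin.last x)
    rw [Fin.val_last] at this
    rw [← this, Finset.sum_range]
    rfl
  · intro z hz
    rw [Finset.mem_range] at hz
    rw [transition, if_neg (by omega), if_neg (by omega)]
    ring

theorem transitionChain_self (β : ℕ → ℂ) (s x y : ℕ) :
    transitionChain β s s x y = if x = y then 1 else 0 := by
  simp [transitionChain]

theorem transitionChain_eq (β : ℕ → ℂ) {s t : ℕ} (h : s < t) (x y : ℕ) :
    transitionChain β s t x y =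
      diffOpDagger (β s) (fun z => transitionChain β (s + 1) t z y) x := by
  rw [← conv_transition]
  unfold transitionChain
  rw [List.Ico.eq_cons h, List.foldr_cons]

/-! ### The space of points of all levels -/

section SpaceTime

variable {N M : ℕ}

/-- The operator that moves a point to the next level, on the points with position below `M`. -/
def moveMat (N M : ℕ) (β : ℕ → ℂ) : Matrix (Fin M × Fin N) (Fin M × Fin N) ℂ :=
  Matrix.of fun u v => if (u.2 : ℕ) + 1 = v.2 then transition (β v.2) u.1 v.1 else 0

/-- The sum over all paths from a point to a point, which is the inverse of `1 - moveMat`. -/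
def pathMat (N M : ℕ) (β : ℕ → ℂ) : Matrix (Fin M × Fin N) (Fin M × Fin N) ℂ :=
  Matrix.of fun u v => if u.2 ≤ v.2 then transitionChain β (u.2 + 1) (v.2 + 1) u.1 v.1 else 0

/-- The functions `Φ_i`, placed on the first level. -/
def startMat (M : ℕ) (Φ : Fin N → ℕ → ℂ) : Matrix (Fin N) (Fin M × Fin N) ℂ :=
  Matrix.of fun i u => if (u.2 : ℕ) = 0 then Φ i u.1 else 0

/-- The functions `Ψ_j`, placed on the last level. -/
def endMat (M : ℕ) (Ψ : Fin N → ℕ → ℂ) : Matrix (Fin M × Fin N) (Fin N) ℂ :=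
  Matrix.of fun u j => if (u.2 : ℕ) + 1 = N then Ψ j u.1 else 0

/-- The functions `D^{[1,t)} Φ_i` on all levels `t`. -/
def forwardMat (M : ℕ) (Φ : Fin N → ℕ → ℂ) (β : ℕ → ℂ) : Matrix (Fin N) (Fin M × Fin N) ℂ :=
  Matrix.of fun i u => diffChain β 1 (u.2 + 1) (Φ i) u.1

/-- The functions `D^{[s,N)†} Ψ_j` on all levels `s`. -/
def backwardMat (M : ℕ) (Ψ : Fin N → ℕ → ℂ) (β : ℕ → ℂ) : Matrix (Fin M × Fin N) (Fin N) ℂ :=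
  Matrix.of fun u j => diffChainDagger β (u.2 + 1) N (Ψ j) u.1

theorem lt_of_moveMat_ne_zero {β : ℕ → ℂ} {u v : Fin M × Fin N} (h : moveMat N M β u v ≠ 0) :
    u.2 < v.2 := by
  by_contra hn
  rw [Fin.lt_def] at hn
  exact h (by rw [moveMat, Matrix.of_apply, if_neg (by omega)])

theorem sum_moveMat_mul {R : Type*} [CommSemiring R] (f : ℂ →+* R) (β : ℕ → ℂ) (u : Fin M × Fin N)
    (q : Fin M × Fin N → R) :
    ∑ v, f (moveMat N M β u v) * q v = if h : (u.2 : ℕ) + 1 < N then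
      ∑ y, f (transMat M (β (u.2 + 1)) u.1 y) * q (y, ⟨u.2 + 1, h⟩) else 0 := by
  rw [Fintype.sum_prod_type_right]
  split_ifs with h
  · rw [Finset.sum_eq_single ⟨u.2 + 1, h⟩]
    · simp [moveMat, transMat]
    · intro t _ ht
      refine Finset.sum_eq_zero fun y _ => ?_
      rw [moveMat, Matrix.of_apply, if_neg fun h => ht (Fin.ext h.symm), map_zero, zero_mul]
    · simp
  · refine Finset.sum_eq_zero fun t _ => Finset.sum_eq_zero fun y _ => ?_
    rw [moveMat, Matrix.of_apply, if_neg (by simp only; omega), map_zero, zero_mul]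

theorem one_sub_moveMat_mul_pathMat (β : ℕ → ℂ) :
    (1 - moveMat N M β) * pathMat N M β = 1 := by
  rw [Matrix.sub_mul, Matrix.one_mul]
  ext u v
  rw [Matrix.sub_apply, Matrix.mul_apply]
  have h0 := sum_moveMat_mul (RingHom.id ℂ) β u fun w => pathMat N M β w v
  simp only [RingHom.id_apply] at h0
  rw [h0]
  rcases lt_trichotomy u.2 v.2 with h | h | h
  · have h1 : (u.2 : ℕ) < v.2 := h
    rw [dif_pos (by omega), Matrix.one_apply_ne fun he => h.ne (by rw [he])]
    have h2 : ∀ y : Fin M, pathMat N M β (y, ⟨u.2 + 1, by omega⟩) v =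
        transitionChain β (u.2 + 1 + 1) (v.2 + 1) y v.1 := fun y => by
      rw [pathMat, Matrix.of_apply, if_pos (by rw [Fin.le_def]; simp only; omega)]
    simp only [h2]
    have h3 := congrFun (transMat_mulVec (M := M) (β (u.2 + 1))
      fun y => transitionChain β (u.2 + 1 + 1) (v.2 + 1) y v.1) u.1
    simp only [Matrix.mulVec, dotProduct] at h3
    rw [h3, pathMat, Matrix.of_apply, if_pos h.le, transitionChain_eq β (by omega), sub_self]
  · have h2 : pathMat N M β u v = (1 : Matrix (Fin M × Fin N) (Fin M × Fin N) ℂ) u v := by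
      rw [pathMat, Matrix.of_apply, if_pos h.le, h, transitionChain_self, Matrix.one_apply]
      congr 1
      rw [Prod.ext_iff, Fin.ext_iff]
      simp [h]
    rw [h2, sub_eq_self]
    split_ifs with h3
    · refine Finset.sum_eq_zero fun y _ => mul_eq_zero_of_right _ (if_neg ?_)
      rw [Fin.le_def, ← h]
      simp
    · rfl
  · have h1 : (v.2 : ℕ) < u.2 := h
    have h2 : pathMat N M β u v = 0 := if_neg (not_le.2 h)
    rw [h2, zero_sub, Matrix.one_apply_ne fun he => h.ne (by rw [he]), neg_eq_zero]
    split_ifs with h3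
    · refine Finset.sum_eq_zero fun y _ => mul_eq_zero_of_right _ (if_neg ?_)
      rw [Fin.le_def]
      simp only
      omega
    · rfl

theorem one_sub_moveMat_mul_backwardMat (Ψ : Fin N → ℕ → ℂ) (β : ℕ → ℂ) :
    (1 - moveMat N M β) * backwardMat M Ψ β = endMat M Ψ := by
  rw [Matrix.sub_mul, Matrix.one_mul]
  ext u j
  rw [Matrix.sub_apply, Matrix.mul_apply]
  have h0 := sum_moveMat_mul (RingHom.id ℂ) β u fun w => backwardMat M Ψ β w j
  simp only [RingHom.id_apply] at h0
  rw [h0]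
  have hu := u.2.2
  split_ifs with h
  · have h3 := congrFun (transMat_mulVec (M := M) (β (u.2 + 1))
      (diffChainDagger β (u.2 + 1 + 1) N (Ψ j))) u.1
    simp only [Matrix.mulVec, dotProduct] at h3
    simp only [backwardMat, endMat, Matrix.of_apply]
    rw [h3, diffChainDagger_eq β (by omega), sub_self, if_neg (by omega)]
  · simp only [backwardMat, endMat, Matrix.of_apply]
    rw [sub_zero, if_pos (by omega), show (u.2 : ℕ) + 1 = N by omega, diffChainDagger_self]

theorem forwardMat_mul_one_sub_moveMat (Φ : Fin N → ℕ → ℂ) (β : ℕ → ℂ) :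
    forwardMat M (fun i => trunc M (Φ i)) β * (1 - moveMat N M β) =
      startMat M fun i => trunc M (Φ i) := by
  rw [Matrix.mul_sub, Matrix.mul_one]
  ext i u
  rw [Matrix.sub_apply, Matrix.mul_apply, Fintype.sum_prod_type_right]
  obtain ⟨y, t⟩ := u
  by_cases ht : (t : ℕ) = 0
  · rw [Finset.sum_eq_zero, sub_zero]
    · simp [forwardMat, startMat, ht, diffChain_self]
    · intro s _
      refine Finset.sum_eq_zero fun x _ => ?_
      rw [moveMat, Matrix.of_apply, if_neg (by simp only; omega), mul_zero]
  · obtain ⟨m, hm⟩ := Nat.exists_eq_succ_of_ne_zero ht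
    have hmN : m < N := by omega
    rw [Finset.sum_eq_single ⟨m, hmN⟩]
    · have h3 := congrFun (vecMul_transMat (M := M) (β (m + 1))
        (f := diffChain β 1 (m + 1) (trunc M (Φ i)))
        (diffChain_trunc_of_le β (by omega) (Φ i) le_rfl)) y
      simp only [Matrix.vecMul, dotProduct, transMat, Matrix.of_apply] at h3
      simp only [forwardMat, startMat, moveMat, Matrix.of_apply, hm]
      simp only [Nat.succ_eq_add_one, if_true]
      rw [h3, diffChain_succ β (by omega), sub_self, if_neg (by omega)]
    · intro s _ hs
      refine Finset.sum_eq_zero fun x _ => ?_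
      rw [moveMat, Matrix.of_apply, if_neg fun h => hs (Fin.ext (by simp only at h ⊢; omega)),
        mul_zero]
    · simp

theorem startMat_mul_pathMat (Φ : Fin N → ℕ → ℂ) (β : ℕ → ℂ) :
    startMat M (fun i => trunc M (Φ i)) * pathMat N M β =
      forwardMat M (fun i => trunc M (Φ i)) β := by
  rw [← forwardMat_mul_one_sub_moveMat Φ β, Matrix.mul_assoc, one_sub_moveMat_mul_pathMat,
    Matrix.mul_one]

theorem pathMat_mul_endMat (Ψ : Fin N → ℕ → ℂ) (β : ℕ → ℂ) :
    pathMat N M β * endMat M Ψ = backwardMat M Ψ β := by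
  rw [← one_sub_moveMat_mul_backwardMat Ψ β, ← Matrix.mul_assoc,
    mul_eq_one_comm.1 (one_sub_moveMat_mul_pathMat β), Matrix.one_mul]

theorem startMat_mul_apply {R : Type*} [CommSemiring R] (f : ℂ →+* R) (hN : 0 < N)
    (Φ : Fin N → ℕ → ℂ) (q : Fin M × Fin N → R) (i : Fin N) :
    ∑ u, f (startMat M Φ i u) * q u = ∑ x : Fin M, f (Φ i x) * q (x, ⟨0, hN⟩) := by
  rw [Fintype.sum_prod_type_right, Finset.sum_eq_single ⟨0, hN⟩]
  · simp [startMat]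
  · intro s _ hs
    refine Finset.sum_eq_zero fun x _ => ?_
    rw [startMat, Matrix.of_apply, if_neg fun h => hs (Fin.ext h), map_zero, zero_mul]
  · simp

theorem gram_trunc_eq (hN : 0 < N) (Φ Ψ : Fin N → ℕ → ℂ) (β : ℕ → ℂ) :
    gram (fun i => trunc M (Φ i)) Ψ β =
      startMat M (fun i => trunc M (Φ i)) * pathMat N M β * endMat M Ψ := by
  rw [startMat_mul_pathMat]
  ext i j
  rw [Matrix.mul_apply, Fintype.sum_prod_type_right, Finset.sum_eq_single ⟨N - 1, by omega⟩]
  · rw [gram, Matrix.of_apply, tsum_eq_sum (s := Finset.range M), Finset.sum_range]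
    · refine Finset.sum_congr rfl fun x _ => ?_
      simp only [forwardMat, endMat, Matrix.of_apply]
      rw [if_pos (by omega), show N - 1 + 1 = N by omega, mul_comm]
    · intro k hk
      rw [diffChain_trunc_of_le β (by omega) (Φ i) (by simpa using hk), mul_zero]
  · intro s _ hs
    refine Finset.sum_eq_zero fun x _ => ?_
    rw [endMat, Matrix.of_apply, if_neg fun h => hs (Fin.ext (by simp only at h ⊢; omega)),
      mul_zero]
  · simp

end SpaceTime

/-! ### The finite identity -/

/-- If all columns outside the range of `e` are those of the identity matrix, the determinant is
that of the submatrix on the range of `e`. -/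
theorem det_eq_det_submatrix {V F R : Type*} [Fintype V] [DecidableEq V] [Fintype F]
    [DecidableEq F] [CommRing R] (A : Matrix V V R) (e : F → V) (he : Function.Injective e)
    (hA : ∀ u v, v ∉ Set.range e → A u v = if u = v then 1 else 0) :
    A.det = (A.submatrix e e).det := by
  classical
  obtain ⟨p, hp⟩ : ∃ p : V → Prop, ∀ v, p v ↔ v ∈ Set.range e := ⟨_, fun _ => Iff.rfl⟩
  have hA' : ∀ u v, ¬ p v → A u v = if u = v then 1 else 0 := fun u v hv =>
    hA u v fun h => hv ((hp v).2 h)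
  rw [A.twoBlockTriangular_det' p
    fun u hu v hv => by rw [hA' u v hv, if_neg fun h : u = v => hv (h ▸ hu)]]
  have h1 : A.toSquareBlockProp (fun v => ¬ p v) = 1 := by
    ext u v
    rw [Matrix.toSquareBlockProp_def, Matrix.of_apply, hA' _ _ v.2, Matrix.one_apply]
    simp only [Subtype.ext_iff]
  have hbij : Function.Bijective fun u : F => (⟨e u, (hp _).2 ⟨u, rfl⟩⟩ : {v // p v}) :=
    ⟨fun u v h => he (congrArg Subtype.val h), fun v =>
      let ⟨u, hu⟩ := (hp v).1 v.2
      ⟨u, Subtype.ext hu⟩⟩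
  rw [h1, Matrix.det_one, mul_one, ← Matrix.det_submatrix_equiv_self (Equiv.ofBijective _ hbij)]
  rfl

section Finite

variable {N M k : ℕ} {i : Fin k → Fin N} {a : Fin k → ℕ}

/-- The factor `∑_p (1 - z_p) χ_{B_{i_p}(a_p)} + ∑_p (1 - w_p) χ_{C_{i_p}(a_p)}` by which the
columns of the kernel are multiplied in `blockMatrix` is the defect of the monomial weight of a
point from `1`. -/
theorem sum_defect_eq (hi : StrictMono i) (v : Point N) :
    ∑ p : Fin k, (1 - varZ ℂ p) * (if v ∈ setB (i p) (a p) then 1 else 0) +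
      ∑ p : Fin k, (1 - varW ℂ p) * (if v ∈ setC (i p) (a p) then 1 else 0) =
      1 - MvPolynomial.monomial (pointExponent i a v.2 v.1) 1 := by
  have hB : ∀ p, v ∈ setB (i p) (a p) ↔ (i p : ℕ) = v.2 ∧ v.1 < a p := fun p => by
    rw [setB, Finset.mem_product, mem_range, mem_singleton, and_comm, Fin.ext_iff, eq_comm]
  have hC : ∀ p, v ∈ setC (i p) (a p) ↔ (i p : ℕ) = v.2 ∧ v.1 = a p := fun p => by
    rw [setC, Finset.mem_product, mem_singleton, mem_singleton, and_comm, Fin.ext_iff,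
      eq_comm (a := (v.2 : ℕ))]
  simp only [hB, hC]
  by_cases h : ∃ p, (i p : ℕ) = v.2
  · obtain ⟨p, hp⟩ := h
    have hne : ∀ q, q ≠ p → (i q : ℕ) ≠ v.2 := fun q hq h =>
      hq (hi.injective (Fin.ext (h.trans hp.symm)))
    rw [Finset.sum_eq_single p (fun q _ hq => by simp [hne q hq]) (by simp),
      Finset.sum_eq_single p (fun q _ hq => by simp [hne q hq]) (by simp)]
    have hexp : ∀ q, pointExponent i a v.2 v.1 q =
        if q = Sum.inl p ∧ v.1 < a p ∨ q = Sum.inr p ∧ v.1 = a p then 1 else 0 := by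
      rintro (q | q) <;> by_cases hq : q = p <;> simp [pointExponent, hp, hne, hq]
    rcases lt_trichotomy v.1 (a p) with hlt | heq | hgt
    · have : pointExponent i a v.2 v.1 = Finsupp.single (Sum.inl p) 1 := by
        ext q
        rw [hexp, Finsupp.single_apply]
        simp [hlt, hlt.ne, eq_comm]
      rw [this, if_pos ⟨hp, hlt⟩, if_neg (by omega)]
      simp [varZ, MvPolynomial.X]
    · have : pointExponent i a v.2 v.1 = Finsupp.single (Sum.inr p) 1 := by
        ext q
        rw [hexp, Finsupp.single_apply]
        simp [heq, eq_comm]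
      rw [this, if_pos (⟨hp, heq⟩ : _ ∧ v.1 = a p), if_neg (by omega)]
      simp [varW, MvPolynomial.X]
    · have : pointExponent i a v.2 v.1 = 0 := by
        ext q
        rw [hexp]
        simp [hgt.not_gt, hgt.ne']
      rw [this, if_neg (by omega), if_neg (by omega)]
      simp
  · push Not at h
    have : pointExponent i a v.2 v.1 = 0 := by
      ext (q | q) <;> simp [pointExponent, h]
    rw [this]
    simp [h]

theorem blockMatrix_apply (hi : StrictMono i) (K : Point N → Point N → ℂ) (u v : setF i a) :
    blockMatrix K i a u v = (if u = v then 1 else 0) -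
      (1 - MvPolynomial.monomial (pointExponent i a v.1.2 v.1.1) 1) *
        MvPolynomial.C (K u.1 v.1) := by
  rw [← sum_defect_eq hi, blockMatrix, Matrix.of_apply, add_mul, Finset.sum_mul, Finset.sum_mul,
    ← sub_sub]
  simp only [mul_assoc, ite_mul, one_mul, zero_mul]

theorem mem_setF (v : Point N) : v ∈ setF i a ↔ ∃ p, v.2 = i p ∧ v.1 ≤ a p := by
  simp only [setF, setB, setC, Finset.mem_biUnion, Finset.mem_univ, true_and, Finset.mem_union,
    Finset.mem_product, Finset.mem_range, Finset.mem_singleton]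
  refine exists_congr fun p => ?_
  rw [← or_and_right, and_comm, le_iff_lt_or_eq]

/-- A complex matrix as a matrix of constant polynomials. -/
def polyMat (k : ℕ) {m n : Type} (A : Matrix m n ℂ) :
    Matrix m n (MvPolynomial (Fin k ⊕ Fin k) ℂ) := A.map MvPolynomial.C

theorem polyMat_apply {m n : Type} (A : Matrix m n ℂ) (u : m) (v : n) :
    polyMat k A u v = MvPolynomial.C (A u v) := rfl

theorem polyMat_mul {l m n : Type} [Fintype m] (A : Matrix l m ℂ) (B : Matrix m n ℂ) :
    polyMat k (A * B) = polyMat k A * polyMat k B := Matrix.map_mul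

theorem polyMat_sub {m n : Type} (A B : Matrix m n ℂ) :
    polyMat k (A - B) = polyMat k A - polyMat k B := Matrix.map_sub _ (map_sub _) _ _

theorem polyMat_one {m : Type} [DecidableEq m] : polyMat k (1 : Matrix m m ℂ) = 1 :=
  Matrix.map_one _ (map_zero _) (map_one _)

theorem det_polyMat {m : Type} [Fintype m] [DecidableEq m] (A : Matrix m m ℂ) :
    (polyMat k A).det = MvPolynomial.C A.det := (RingHom.map_det _ _).symm

/-- The matrix in the Eynard–Mehta formula is the transpose of the kernel `K`: the identity removes
the terms with `t = s` from the sum over paths. -/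
theorem backward_mul_forward_apply (Φ Ψ : Fin N → ℕ → ℂ) (β : ℕ → ℂ) (u v : Fin M × Fin N) :
    (backwardMat M Ψ β * (gram Φ Ψ β)⁻¹ * forwardMat M Φ β - (pathMat N M β - 1) :
      Matrix (Fin M × Fin N) (Fin M × Fin N) ℂ) v u =
      kernel Φ Ψ β (u.1, u.2) (v.1, v.2) := by
  rw [Matrix.sub_apply, Matrix.mul_apply, kernel, sub_eq_neg_add]
  congr 1
  · rw [neg_inj, Matrix.sub_apply, pathMat, Matrix.of_apply]
    rcases lt_trichotomy v.2 u.2 with h | h | h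
    · rw [if_pos h.le, if_pos h, Matrix.one_apply_ne fun he => h.ne (by rw [he]), sub_zero]
    · rw [if_pos h.le, if_neg h.not_lt, h, transitionChain_self, Matrix.one_apply, sub_eq_zero]
      congr 1
      rw [Prod.ext_iff, Fin.ext_iff]
      simp [h]
    · rw [if_neg (not_le.2 h), if_neg h.not_gt, Matrix.one_apply_ne fun he => h.ne (by rw [he]),
        sub_zero]
  · refine Finset.sum_congr rfl fun i _ => ?_
    rw [Matrix.mul_apply, Finset.sum_mul]
    refine Finset.sum_congr rfl fun j _ => ?_
    simp only [backwardMat, forwardMat, Matrix.of_apply]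
    ring

/-- The diagonal matrix of the monomial weights of the points. -/
def weightMat (i : Fin k → Fin N) (a : Fin k → ℕ) (M : ℕ) :
    Matrix (Fin M × Fin N) (Fin M × Fin N) (MvPolynomial (Fin k ⊕ Fin k) ℂ) :=
  Matrix.diagonal fun u => MvPolynomial.monomial (pointExponent i a u.2 u.1) 1

/-- The Fredholm determinant on all points below `M`, with rows and columns transposed, reduces to
the points of `F`, outside of which the weights are trivial. -/
theorem det_fredholm_eq (hi : StrictMono i) (ha : ∀ p, a p < M) (Φ Ψ : Fin N → ℕ → ℂ)
    (β : ℕ → ℂ) :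
    (1 - (1 - weightMat i a M) * polyMat k (backwardMat M Ψ β * (gram Φ Ψ β)⁻¹ *
      forwardMat M Φ β - (pathMat N M β - 1))).det =
      (blockMatrix (kernel Φ Ψ β) i a).det := by
  have hlt : ∀ u : setF i a, u.1.1 < M := fun u => by
    obtain ⟨p, -, hp⟩ := (mem_setF u.1).1 u.2
    exact hp.trans_lt (ha p)
  have happ : ∀ u v : Fin M × Fin N,
      (1 - (1 - weightMat i a M) * polyMat k (backwardMat M Ψ β * (gram Φ Ψ β)⁻¹ *
        forwardMat M Φ β - (pathMat N M β - 1))).transpose u v = (if u = v then 1 else 0) -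
      (1 - MvPolynomial.monomial (pointExponent i a v.2 v.1) 1) *
        MvPolynomial.C (kernel Φ Ψ β (u.1, u.2) (v.1, v.2)) := fun u v => by
    rw [Matrix.transpose_apply, Matrix.sub_apply, Matrix.one_apply, weightMat,
      ← Matrix.diagonal_one, Matrix.diagonal_sub, Matrix.diagonal_mul, polyMat_apply,
      backward_mul_forward_apply]
    simp only [eq_comm]
  rw [← Matrix.det_transpose, det_eq_det_submatrix _
    (fun u : setF i a => ((⟨u.1.1, hlt u⟩, u.1.2) : Fin M × Fin N))]
  · congr 1
    refine Matrix.ext fun u v => ?_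
    rw [Matrix.submatrix_apply, happ, blockMatrix_apply hi]
    congr 1
    simp only [Prod.ext_iff, Fin.ext_iff, Subtype.ext_iff]
  · intro u v huv
    rw [Prod.ext_iff, Fin.ext_iff] at huv
    exact Subtype.ext (Prod.ext huv.1 huv.2)
  · intro u v hv
    rw [happ]
    have : pointExponent i a v.2 v.1 = 0 := by
      have hn : ∀ p, (i p : ℕ) = v.2 → ¬ (v.1 : ℕ) ≤ a p := fun p h1 h2 => hv
        ⟨⟨((v.1 : ℕ), v.2), (mem_setF _).2 ⟨p, Fin.ext h1.symm, h2⟩⟩, rfl⟩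
      ext (p | p)
      · simp only [pointExponent, Finsupp.equivFunOnFinite_symm_apply_apply, Sum.elim_inl,
          Finsupp.coe_zero, Pi.zero_apply]
        exact if_neg fun h => hn p h.1 h.2.le
      · simp only [pointExponent, Finsupp.equivFunOnFinite_symm_apply_apply, Sum.elim_inr,
          Finsupp.coe_zero, Pi.zero_apply]
        exact if_neg fun h => hn p h.1 h.2.le
    rw [this]
    simp

/-- The weighted backward functions on all levels. -/
def weightedMat (i : Fin k → Fin N) (a : Fin k → ℕ) (M : ℕ) (Ψ : Fin N → ℕ → ℂ) (β : ℕ → ℂ) :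
    Matrix (Fin M × Fin N) (Fin N) (MvPolynomial (Fin k ⊕ Fin k) ℂ) :=
  Matrix.of fun u j => weightedChain i a (fun s => transMat M (β (s + 1))) (fun x => Ψ j x)
    (N - 1 - u.2) u.2 u.1

theorem one_sub_weightMat_mul_weightedMat (Ψ : Fin N → ℕ → ℂ) (β : ℕ → ℂ) :
    (1 - weightMat i a M * polyMat k (moveMat N M β)) * weightedMat i a M Ψ β =
      weightMat i a M * polyMat k (endMat M Ψ) := by
  rw [Matrix.sub_mul, Matrix.one_mul, Matrix.mul_assoc]
  refine Matrix.ext fun u j => ?_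
  rw [Matrix.sub_apply, weightMat, Matrix.diagonal_mul, Matrix.diagonal_mul, Matrix.mul_apply]
  have h0 := sum_moveMat_mul (MvPolynomial.C (σ := Fin k ⊕ Fin k)) β u
    fun w => weightedMat i a M Ψ β w j
  simp only [polyMat_apply]
  rw [h0]
  have hu := u.2.2
  split_ifs with h
  · obtain ⟨n, hn⟩ := Nat.exists_eq_add_of_lt h
    have h1 : N - 1 - (u.2 : ℕ) = n + 1 := by omega
    have h2 : N - 1 - ((u.2 : ℕ) + 1) = n := by omega
    simp only [weightedMat, endMat, Matrix.of_apply, h1, h2, weightedChain]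
    rw [if_neg (by omega), map_zero, mul_zero, sub_eq_zero]
    rfl
  · have h1 : N - 1 - (u.2 : ℕ) = 0 := by omega
    simp only [weightedMat, endMat, Matrix.of_apply, h1, weightedChain]
    rw [if_pos (by omega), mul_zero, sub_zero]

theorem det_startMat_mul_weightedMat (hi : StrictMono i) (hN : 0 < N) (ha : ∀ p, a p < M)
    (Φ Ψ : Fin N → ℕ → ℂ) (β : ℕ → ℂ)
    (hG : (gram (fun i => trunc M (Φ i)) Ψ β).det ≠ 0) :
    (polyMat k (startMat M fun i => trunc M (Φ i)) * weightedMat i a M Ψ β).det =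
      MvPolynomial.C (gram (fun i => trunc M (Φ i)) Ψ β).det *
        (blockMatrix (kernel (fun i => trunc M (Φ i)) Ψ β) i a).det := by
  set Φ' := fun i => trunc M (Φ i) with hΦ'
  have hgram := gram_trunc_eq (M := M) hN Φ Ψ β
  rw [← hΦ'] at hgram
  have key := det_weighted_eq_det_mul_fredholm (a := polyMat k (startMat M Φ'))
    (b := polyMat k (endMat M Ψ)) (Ξ := weightedMat i a M Ψ β)
    (D := polyMat k (moveMat N M β)) (U := polyMat k (pathMat N M β))
    (g := weightMat i a M) (Γ := polyMat k (gram Φ' Ψ β)⁻¹) ?_ ?_ ?_ ?_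
    (one_sub_weightMat_mul_weightedMat Ψ β)
  · rw [key, ← det_fredholm_eq hi ha, ← polyMat_mul, ← polyMat_mul, ← hgram, det_polyMat,
      ← polyMat_mul, ← polyMat_mul, ← polyMat_mul, startMat_mul_pathMat,
      pathMat_mul_endMat, ← hΦ', ← polyMat_one, ← polyMat_sub, ← polyMat_sub, polyMat_one]
  · rw [← polyMat_one, ← polyMat_sub, ← polyMat_mul, one_sub_moveMat_mul_pathMat]
  · refine det_one_sub_eq_one (fun u => u.2) fun u v h => ?_
    exact lt_of_moveMat_ne_zero (β := β) fun h0 => h (by rw [polyMat_apply, h0, map_zero])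
  · refine det_one_sub_eq_one (fun u => u.2) fun u v h => ?_
    rw [weightMat, Matrix.diagonal_mul, polyMat_apply] at h
    exact lt_of_moveMat_ne_zero (β := β) fun h0 => h (by rw [h0, map_zero, mul_zero])
  · rw [← polyMat_mul, ← polyMat_mul, ← hgram, ← polyMat_mul,
      Matrix.mul_nonsing_inv _ (isUnit_iff_ne_zero.2 hG), polyMat_one]

theorem startMat_mul_weightedMat (hN : 0 < N) (Φ Ψ : Fin N → ℕ → ℂ) (β : ℕ → ℂ) :
    polyMat k (startMat M Φ) * weightedMat i a M Ψ β =
      Matrix.of fun j l => ∑ x : Fin M, MvPolynomial.C (Φ j x) *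
        weightedChain i a (fun s => transMat M (β (s + 1))) (fun x => Ψ l x) (N - 1) 0 x := by
  refine Matrix.ext fun j l => ?_
  rw [Matrix.mul_apply]
  exact startMat_mul_apply MvPolynomial.C hN Φ (fun u => weightedMat i a M Ψ β u l) j

open Classical in
theorem coeff_det_startMat_mul_weightedMat (hN : 0 < N) (Φ Ψ : Fin N → ℕ → ℂ) (β : ℕ → ℂ) :
    MvPolynomial.coeff (targetExponent i)
        (polyMat k (startMat M fun i => trunc M (Φ i)) * weightedMat i a M Ψ β).det =
      ∑ x ∈ univ.filter fun x : Fin N → Fin M => StrictAnti x ∧ ∀ p, (x (i p) : ℕ) = a p,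
        (Matrix.of fun i j : Fin N => diffChain β 1 (j + 1) (trunc M (Φ i)) (x j)).det *
          (Matrix.of fun i j : Fin N => diffChainDagger β (j + 1) N (Ψ i) (x j)).det := by
  have := coeff_det_pairing (i := i) (a := a) hN
    (T := fun s => transMat M (β (s + 1))) (fun s => isDescending_transMat M _)
    (φ := fun s i x => diffChain β 1 (s + 1) (trunc M (Φ i)) x)
    (ψ := fun s i x => diffChainDagger β (s + 1) N (Ψ i) x) ?_ ?_
  · rw [startMat_mul_weightedMat hN, ← this]
    simp only [zero_add, diffChain_self, Nat.sub_add_cancel hN, diffChainDagger_self]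
  · intro s _ i
    rw [vecMul_transMat _ (diffChain_trunc_of_le β (by omega) _ le_rfl)]
    funext x
    rw [diffChain_succ β (by omega)]
  · intro s hs i
    rw [transMat_mulVec]
    funext x
    rw [diffChainDagger_eq β hs]

/-- Cutting off the functions `Φ_i` to `{0, …, M - 1}` restricts the weight to the configurations
below `M`, since `D^{[1,j)} Φ_i` at `ℓ_j` involves only the values at `ℓ_j, …, ℓ_j + j - 1`, and
`ℓ_j + j - 1 ≤ ℓ_1 < M`. -/
theorem det_diffChain_trunc (Φ : Fin N → ℕ → ℂ) (β : ℕ → ℂ) {x : Fin N → ℕ} (hx : StrictAnti x)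
    (hM : ∀ j, x j < M) :
    (Matrix.of fun i j : Fin N => diffChain β 1 (j + 1) (trunc M (Φ i)) (x j)).det =
      (Matrix.of fun i j : Fin N => diffChain β 1 (j + 1) (Φ i) (x j)).det := by
  have hadd : ∀ (n : ℕ) (hn : n < N), x ⟨n, hn⟩ + n < M := by
    intro n
    induction n with
    | zero => intro hn; exact hM _
    | succ n ih =>
      intro hn
      have h1 := ih (by omega)
      have h2 : x ⟨n + 1, hn⟩ < x ⟨n, by omega⟩ := hx (by rw [Fin.lt_def]; simp)
      omega
  congr 2
  funext i j
  refine diffChain_congr β (by omega) fun m _ hm => trunc_of_lt _ ?_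
  have := hadd j j.2
  simp only [Fin.eta] at this
  omega

/-- The configurations with all points below `M`. -/
def configsBelow (N M : ℕ) : Finset (Config N) :=
  ((Set.Finite.pi' fun _ : Fin N => Set.finite_Iio M).preimage
    (f := fun X : Config N => X.1) Subtype.val_injective.injOn).toFinset

theorem mem_configsBelow (X : Config N) : X ∈ configsBelow N M ↔ ∀ j, X.1 j < M := by
  simp [configsBelow]

open Classical in
theorem sum_configsBelow_eq (Φ Ψ : Fin N → ℕ → ℂ) (β : ℕ → ℂ) :
    ∑ X ∈ configsBelow N M, (if ∀ p, X.1 (i p) = a p then weight Φ Ψ β X else 0) =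
      ∑ x ∈ univ.filter fun x : Fin N → Fin M => StrictAnti x ∧ ∀ p, (x (i p) : ℕ) = a p,
        (Matrix.of fun i j : Fin N => diffChain β 1 (j + 1) (trunc M (Φ i)) (x j)).det *
          (Matrix.of fun i j : Fin N => diffChainDagger β (j + 1) N (Ψ i) (x j)).det := by
  rw [← Finset.sum_filter]
  refine Finset.sum_bij (fun X hX j => ⟨X.1 j, (mem_configsBelow X).1 (mem_filter.1 hX).1 j⟩)
    ?_ ?_ ?_ ?_
  · intro X hX
    exact mem_filter.2 ⟨mem_univ _, fun l m h => X.2 h, (mem_filter.1 hX).2⟩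
  · intro X _ Y _ h
    exact Subtype.ext (funext fun j => congrArg Fin.val (congrFun h j))
  · intro x hx
    obtain ⟨-, h1, h2⟩ := mem_filter.1 hx
    exact ⟨⟨fun j => x j, fun l m h => h1 h⟩,
      mem_filter.2 ⟨(mem_configsBelow _).2 fun j => (x j).2, h2⟩, rfl⟩
  · intro X hX
    rw [weight, ← det_diffChain_trunc Φ β X.2 ((mem_configsBelow X).1 (mem_filter.1 hX).1)]

open Classical in
/-- The marginal formula for the functions `Φ_i` cut off to `{0, …, M - 1}`. -/
theorem sum_configsBelow_eq_det_mul_detCoeff (hi : StrictMono i) (hN : 0 < N)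
    (ha : ∀ p, a p < M) (Φ Ψ : Fin N → ℕ → ℂ) (β : ℕ → ℂ)
    (hG : (gram (fun i => trunc M (Φ i)) Ψ β).det ≠ 0) :
    ∑ X ∈ configsBelow N M, (if ∀ p, X.1 (i p) = a p then weight Φ Ψ β X else 0) =
      (gram (fun i => trunc M (Φ i)) Ψ β).det *
        detCoeff (kernel (fun i => trunc M (Φ i)) Ψ β) i a := by
  rw [sum_configsBelow_eq, ← coeff_det_startMat_mul_weightedMat hN,
    det_startMat_mul_weightedMat hi hN ha Φ Ψ β hG, MvPolynomial.coeff_C_mul]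
  rfl

/-- The normalizing constant for the functions `Φ_i` cut off to `{0, …, M - 1}`. -/
theorem sum_configsBelow_weight (hN : 0 < N) (Φ Ψ : Fin N → ℕ → ℂ) (β : ℕ → ℂ) :
    ∑ X ∈ configsBelow N M, weight Φ Ψ β X = (gram (fun i => trunc M (Φ i)) Ψ β).det := by
  classical
  -- without marked points all the weights are trivial
  have h := sum_configsBelow_eq (M := M) (i := (Fin.elim0 : Fin 0 → Fin N))
    (a := (Fin.elim0 : Fin 0 → ℕ)) Φ Ψ β
  simp only [IsEmpty.forall_iff, if_true] at h
  rw [h]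
  have h1 := coeff_det_startMat_mul_weightedMat (M := M) (i := (Fin.elim0 : Fin 0 → Fin N))
    (a := (Fin.elim0 : Fin 0 → ℕ)) hN Φ Ψ β
  simp only [IsEmpty.forall_iff] at h1
  rw [← h1]
  have hΞ : weightedMat (Fin.elim0 : Fin 0 → Fin N) (Fin.elim0 : Fin 0 → ℕ) M Ψ β =
      polyMat 0 (backwardMat M Ψ β) := by
    have hw : weightMat (Fin.elim0 : Fin 0 → Fin N) (Fin.elim0 : Fin 0 → ℕ) M = 1 := by
      rw [weightMat, ← Matrix.diagonal_one]
      congr 1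
      funext u
      rw [Subsingleton.elim (pointExponent _ _ _ _) 0]
      rfl
    have h2 := one_sub_weightMat_mul_weightedMat (M := M) (i := (Fin.elim0 : Fin 0 → Fin N))
      (a := (Fin.elim0 : Fin 0 → ℕ)) Ψ β
    rw [hw, Matrix.one_mul, Matrix.one_mul, ← polyMat_one, ← polyMat_sub] at h2
    rw [← pathMat_mul_endMat, polyMat_mul, ← h2, ← Matrix.mul_assoc, ← polyMat_mul,
      mul_eq_one_comm.1 (one_sub_moveMat_mul_pathMat β), polyMat_one, Matrix.one_mul]
  rw [hΞ, ← polyMat_mul, gram_trunc_eq hN, Matrix.mul_assoc, pathMat_mul_endMat, det_polyMat,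
    Subsingleton.elim (targetExponent _) 0, MvPolynomial.coeff_zero_C]

end Finite

/-! ### Convergence of the cut-off quantities -/

theorem diffChain_eq_sum_powerset (β : ℕ → ℂ) {a b : ℕ} (h : a ≤ b) (f : ℕ → ℂ) (k : ℕ) :
    diffChain β a b f k =
      ∑ S ∈ (Ico a b).powerset, (∏ r ∈ S, -β r) * f (k + S.card) := by
  induction b, h using Nat.le_induction generalizing k with
  | base => simp [diffChain_self]
  | succ b hb ih =>
    have hI : Ico a (b + 1) = insert b (Ico a b) := by
      ext m
      simp only [mem_insert, mem_Ico]
      omega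
    rw [diffChain_succ β hb, diffOp, hI, Finset.sum_powerset_insert (by simp), ih, ih,
      sub_eq_add_neg, ← neg_mul, Finset.mul_sum]
    congr 1
    refine Finset.sum_congr rfl fun S hS => ?_
    have hbS : b ∉ S := fun h => by simpa using mem_powerset.1 hS h
    rw [Finset.prod_insert hbS, Finset.card_insert_of_notMem hbS, mul_assoc,
      show k + 1 + S.card = k + (S.card + 1) by omega]

section Limits

variable {N : ℕ}

/-- The term of the multiple series at the path that ends at `k` and makes a downward step exactly
at the levels in `S`. -/
theorem convTerm_eq (Φ Ψ : Fin N → ℕ → ℂ) (β : ℕ → ℂ) (i j : Fin N) {S : Finset ℕ}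
    (hS : S ⊆ Ico 1 N) (k : ℕ) :
    convTerm Φ Ψ β i j (fun m => k + (S.filter fun r => (m : ℕ) < r).card) =
      (∏ r ∈ S, -β r) * (Φ i (k + S.card) * Ψ j k) := by
  have h0 : (S.filter fun r => 0 < r) = S :=
    Finset.filter_true_of_mem fun r hr => by have := mem_Ico.1 (hS hr); omega
  have h1 : (S.filter fun r => N - 1 < r) = ∅ :=
    Finset.filter_false_of_mem fun r hr => by have := mem_Ico.1 (hS hr); omega
  have h2 : ∀ m : ℕ, transition (β (m + 1)) (k + (S.filter fun r => m < r).card)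
      (k + (S.filter fun r => m + 1 < r).card) = if m + 1 ∈ S then -β (m + 1) else 1 := by
    intro m
    by_cases hm : m + 1 ∈ S
    · have : (S.filter fun r => m < r) = insert (m + 1) (S.filter fun r => m + 1 < r) := by
        ext r
        simp only [mem_filter, mem_insert]
        constructor
        · rintro ⟨h1, h2⟩
          by_cases hr : r = m + 1
          · exact Or.inl hr
          · exact Or.inr ⟨h1, by omega⟩
        · rintro (rfl | ⟨h1, h2⟩)
          · exact ⟨hm, by omega⟩
          · exact ⟨h1, by omega⟩
      rw [this, Finset.card_insert_of_notMem (by simp), if_pos hm, transition, if_neg (by omega),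
        if_pos (by omega)]
      ring
    · have : (S.filter fun r => m < r) = S.filter fun r => m + 1 < r := by
        refine Finset.filter_congr fun r hr => ?_
        have : r ≠ m + 1 := fun h => hm (h ▸ hr)
        omega
      rw [this, if_neg hm, transition, if_pos rfl, if_neg (by omega)]
      ring
  have h3 : ∏ r ∈ S, -β r = ∏ m ∈ range (N - 1), if m + 1 ∈ S then -β (m + 1) else 1 := by
    rw [Finset.range_eq_Ico, Finset.prod_Ico_add' (fun r => if r ∈ S then -β r else 1),
      Finset.prod_ite_mem]
    refine Finset.prod_congr ?_ fun _ _ => rfl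
    rw [Finset.inter_eq_right.2]
    intro r hr
    have := mem_Ico.1 (hS hr)
    exact mem_Ico.2 (by omega)
  rw [convTerm, h3, ← Fin.prod_univ_eq_prod_range]
  simp only [h0, h1, h2, Finset.card_empty, add_zero]
  ring

theorem summable_of_convolutionsConverge {Φ Ψ : Fin N → ℕ → ℂ} {β : ℕ → ℂ}
    (h : ConvolutionsConverge Φ Ψ β) (i j : Fin N) {S : Finset ℕ} (hS : S ⊆ Ico 1 N) :
    Summable fun k => (∏ r ∈ S, -β r) * (Φ i (k + S.card) * Ψ j k) := by
  have hinj : Function.Injective fun (k : ℕ) (m : Fin N) =>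
      k + (S.filter fun r => (m : ℕ) < r).card := fun k l hkl => by
    have := congrFun hkl i
    simp only at this
    omega
  refine ((h i j).comp_injective hinj).congr fun k => ?_
  exact convTerm_eq Φ Ψ β i j hS k

open Filter Topology

theorem eventually_diffChain_trunc_eq (β : ℕ → ℂ) {a b : ℕ} (h : a ≤ b) (f : ℕ → ℂ) (k : ℕ) :
    ∀ᶠ M in atTop, diffChain β a b (trunc M f) k = diffChain β a b f k := by
  filter_upwards [eventually_gt_atTop (k + (b - a))] with M hM
  exact diffChain_congr β h fun m _ hm => trunc_of_lt f (by omega)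

theorem tendsto_gram_trunc {Φ Ψ : Fin N → ℕ → ℂ} {β : ℕ → ℂ} (h : ConvolutionsConverge Φ Ψ β) :
    Tendsto (fun M => gram (fun i => trunc M (Φ i)) Ψ β) atTop (𝓝 (gram Φ Ψ β)) := by
  refine tendsto_pi_nhds.2 fun i => tendsto_pi_nhds.2 fun j => ?_
  have hN : 1 ≤ N := i.pos
  refine tendsto_tsum_of_dominated_convergence
    (bound := fun k => ∑ S ∈ (Ico 1 N).powerset, ‖(∏ r ∈ S, -β r) * (Φ i (k + S.card) * Ψ j k)‖)
    ?_ ?_ ?_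
  · exact summable_sum fun S hS =>
      (summable_of_convolutionsConverge h i j (mem_powerset.1 hS)).norm
  · intro k
    refine Tendsto.const_mul _ (tendsto_const_nhds.congr' ?_)
    filter_upwards [eventually_diffChain_trunc_eq β hN (Φ i) k] with M hM
    exact hM.symm
  · refine Eventually.of_forall fun M k => ?_
    rw [diffChain_eq_sum_powerset β hN, Finset.mul_sum]
    refine (norm_sum_le _ _).trans (Finset.sum_le_sum fun S _ => ?_)
    rw [mul_left_comm, mul_comm (Ψ j k), norm_mul, norm_mul, norm_mul, norm_mul]
    gcongr
    change ‖trunc M (Φ i) (k + S.card)‖ ≤ _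
    unfold trunc
    split_ifs
    · exact le_rfl
    · rw [norm_zero]; exact norm_nonneg _

theorem tendsto_kernel_trunc {Φ Ψ : Fin N → ℕ → ℂ} {β : ℕ → ℂ} (h : ConvolutionsConverge Φ Ψ β)
    (hG : (gram Φ Ψ β).det ≠ 0) (u v : Point N) :
    Tendsto (fun M => kernel (fun i => trunc M (Φ i)) Ψ β u v) atTop (𝓝 (kernel Φ Ψ β u v)) := by
  have hgram := tendsto_gram_trunc h
  have hinv : Tendsto (fun M => (gram (fun i => trunc M (Φ i)) Ψ β)⁻¹) atTop
      (𝓝 (gram Φ Ψ β)⁻¹) := by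
    simp only [Matrix.inv_def, Ring.inverse_eq_inv']
    exact (((continuous_id.matrix_det).tendsto _).comp hgram).inv₀ hG |>.smul
      (((continuous_id.matrix_adjugate).tendsto _).comp hgram)
  unfold kernel
  refine tendsto_const_nhds.add (tendsto_finsetSum _ fun i _ => tendsto_finsetSum _ fun j _ => ?_)
  refine Tendsto.mul_const _ (Tendsto.mul ?_ ?_)
  · exact tendsto_pi_nhds.1 (tendsto_pi_nhds.1 hinv j) i
  · refine tendsto_const_nhds.congr' ?_
    filter_upwards [eventually_diffChain_trunc_eq β (Nat.le_add_left 1 u.2) (Φ i) u.1] with M hM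
    exact hM.symm

/-- Convergence of the coefficients of a sequence of polynomials. -/
def CoeffTendsto {σ : Type*} (q : ℕ → MvPolynomial σ ℂ) (q₀ : MvPolynomial σ ℂ) : Prop :=
  ∀ d, Tendsto (fun n => (q n).coeff d) atTop (𝓝 (q₀.coeff d))

theorem CoeffTendsto.const {σ : Type*} (q₀ : MvPolynomial σ ℂ) : CoeffTendsto (fun _ => q₀) q₀ :=
  fun _ => tendsto_const_nhds

theorem CoeffTendsto.C {σ : Type*} {b : ℕ → ℂ} {b₀ : ℂ} (h : Tendsto b atTop (𝓝 b₀)) :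
    CoeffTendsto (σ := σ) (fun n => MvPolynomial.C (b n)) (MvPolynomial.C b₀) := by
  classical
  intro d
  simp only [MvPolynomial.coeff_C]
  split_ifs
  · exact h
  · exact tendsto_const_nhds

theorem CoeffTendsto.mul {σ : Type*} {p q : ℕ → MvPolynomial σ ℂ} {p₀ q₀ : MvPolynomial σ ℂ}
    (hp : CoeffTendsto p p₀) (hq : CoeffTendsto q q₀) :
    CoeffTendsto (fun n => p n * q n) (p₀ * q₀) := by
  classical
  intro d
  simp only [MvPolynomial.coeff_mul]
  exact tendsto_finsetSum _ fun e _ => (hp _).mul (hq _)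

theorem CoeffTendsto.sub {σ : Type*} {p q : ℕ → MvPolynomial σ ℂ} {p₀ q₀ : MvPolynomial σ ℂ}
    (hp : CoeffTendsto p p₀) (hq : CoeffTendsto q q₀) :
    CoeffTendsto (fun n => p n - q n) (p₀ - q₀) := fun d => by
  simpa only [MvPolynomial.coeff_sub] using (hp d).sub (hq d)

theorem CoeffTendsto.sum {σ ι : Type*} (s : Finset ι) {p : ℕ → ι → MvPolynomial σ ℂ}
    {p₀ : ι → MvPolynomial σ ℂ} (hp : ∀ l ∈ s, CoeffTendsto (fun n => p n l) (p₀ l)) :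
    CoeffTendsto (fun n => ∑ l ∈ s, p n l) (∑ l ∈ s, p₀ l) := fun d => by
  simpa only [MvPolynomial.coeff_sum] using tendsto_finsetSum _ fun l hl => hp l hl d

theorem CoeffTendsto.prod {σ ι : Type*} (s : Finset ι) {p : ℕ → ι → MvPolynomial σ ℂ}
    {p₀ : ι → MvPolynomial σ ℂ} (hp : ∀ l ∈ s, CoeffTendsto (fun n => p n l) (p₀ l)) :
    CoeffTendsto (fun n => ∏ l ∈ s, p n l) (∏ l ∈ s, p₀ l) := by
  classical
  induction s using Finset.induction_on with
  | empty => simpa using CoeffTendsto.const 1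
  | insert l s hl ih =>
    simp only [Finset.prod_insert hl]
    exact (hp l (mem_insert_self l s)).mul (ih fun m hm => hp m (mem_insert_of_mem hm))

theorem tendsto_detCoeff {k : ℕ} (i : Fin k → Fin N) (a : Fin k → ℕ)
    {K : ℕ → Point N → Point N → ℂ} {K₀ : Point N → Point N → ℂ}
    (hK : ∀ u v, Tendsto (fun n => K n u v) atTop (𝓝 (K₀ u v))) :
    Tendsto (fun n => detCoeff (K n) i a) atTop (𝓝 (detCoeff K₀ i a)) := by
  have hif : ∀ (P : Prop) [Decidable P] (u v : Point N), CoeffTendsto (σ := Fin k ⊕ Fin k)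
      (fun n => if P then MvPolynomial.C (K n u v) else 0)
      (if P then MvPolynomial.C (K₀ u v) else 0) := fun P _ u v => by
    split_ifs
    · exact CoeffTendsto.C (hK u v)
    · exact CoeffTendsto.const 0
  have hentry : ∀ u v, CoeffTendsto (fun n => blockMatrix (K n) i a u v)
      (blockMatrix K₀ i a u v) := fun u v =>
    ((CoeffTendsto.const _).sub (CoeffTendsto.sum _ fun p _ =>
      (CoeffTendsto.const _).mul (hif _ _ _))).sub
      (CoeffTendsto.sum _ fun p _ => (CoeffTendsto.const _).mul (hif _ _ _))
  have hdet : CoeffTendsto (fun n => (blockMatrix (K n) i a).det) (blockMatrix K₀ i a).det := by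
    simp only [Matrix.det_apply']
    exact CoeffTendsto.sum _ fun σ _ =>
      (CoeffTendsto.const _).mul (CoeffTendsto.prod _ fun l _ => hentry _ _)
  exact hdet _

theorem tendsto_configsBelow : Tendsto (configsBelow N) atTop atTop := by
  refine tendsto_atTop_finset_of_monotone (fun M M' h X hX => ?_) fun X => ?_
  · rw [mem_configsBelow] at hX ⊢
    exact fun j => (hX j).trans_le h
  · refine ⟨∑ j, X.1 j + 1, (mem_configsBelow X).2 fun j => ?_⟩
    exact Nat.lt_succ_of_le (Finset.single_le_sum (fun _ _ => Nat.zero_le _) (mem_univ j))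

theorem summable_weight {Φ Ψ : Fin N → ℕ → ℂ} {β : ℕ → ℂ} (hZ : normConst Φ Ψ β ≠ 0) :
    Summable (weight Φ Ψ β) := by
  by_contra h
  exact hZ (tsum_eq_zero_of_not_summable h)

open Classical in
theorem prob_eq_tsum_div (Φ Ψ : Fin N → ℕ → ℂ) (β : ℕ → ℂ) (P : Config N → Prop) :
    prob Φ Ψ β {X | P X} = (∑' X, if P X then weight Φ Ψ β X else 0) / normConst Φ Ψ β := by
  have h : prob Φ Ψ β {X | P X} = ∑' X, Set.indicator {X | P X} (ensemble Φ Ψ β) X :=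
    tsum_subtype _ _
  rw [h, ← tsum_div_const]
  refine tsum_congr fun X => ?_
  rw [Set.indicator_apply, ite_div, zero_div]
  rfl

open Classical in
theorem summable_ite_weight {Φ Ψ : Fin N → ℕ → ℂ} {β : ℕ → ℂ} (hZ : normConst Φ Ψ β ≠ 0)
    (P : Config N → Prop) : Summable fun X => if P X then weight Φ Ψ β X else 0 :=
  (summable_weight hZ).indicator {X | P X}

/-- The determinant of the Gram matrix is the normalizing constant, and hence nonzero, so that the
inverse in the kernel is the true one. -/
theorem det_gram_eq_normConst {Φ Ψ : Fin N → ℕ → ℂ} {β : ℕ → ℂ} (hN : 0 < N)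
    (h : ConvolutionsConverge Φ Ψ β) (hZ : normConst Φ Ψ β ≠ 0) :
    (gram Φ Ψ β).det = normConst Φ Ψ β := by
  refine tendsto_nhds_unique
    (((continuous_id.matrix_det).tendsto _).comp (tendsto_gram_trunc h)) ?_
  have := (summable_weight hZ).hasSum.comp tendsto_configsBelow
  refine this.congr fun M => ?_
  exact sum_configsBelow_weight hN Φ Ψ β

theorem prob_eq_detCoeff {Φ Ψ : Fin N → ℕ → ℂ} {β : ℕ → ℂ} (hN : 0 < N)
    (h : ConvolutionsConverge Φ Ψ β) (hZ : normConst Φ Ψ β ≠ 0) {k : ℕ} {i : Fin k → Fin N}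
    (hi : StrictMono i) (a : Fin k → ℕ) :
    prob Φ Ψ β {X | ∀ p, X.1 (i p) = a p} = detCoeff (kernel Φ Ψ β) i a := by
  classical
  have hG := det_gram_eq_normConst hN h hZ
  have hG0 : (gram Φ Ψ β).det ≠ 0 := by rw [hG]; exact hZ
  have hdet := ((continuous_id.matrix_det).tendsto _).comp (tendsto_gram_trunc h)
  have hlim := hdet.mul (tendsto_detCoeff i a (tendsto_kernel_trunc h hG0))
  have hsum := (summable_ite_weight hZ fun X => ∀ p, X.1 (i p) = a p).hasSum.comp
    tendsto_configsBelow
  rw [prob_eq_tsum_div, div_eq_iff hZ, mul_comm]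
  refine tendsto_nhds_unique hsum ((hG ▸ hlim).congr' ?_)
  filter_upwards [hdet.eventually_ne hG0, eventually_gt_atTop (∑ p, a p)] with M hM1 hM2
  have ha : ∀ p, a p < M := fun p =>
    (Finset.single_le_sum (fun _ _ => Nat.zero_le _) (mem_univ p)).trans_lt hM2
  have := sum_configsBelow_eq_det_mul_detCoeff hi hN ha Φ Ψ β hM1
  refine Eq.trans this.symm (Finset.sum_congr rfl fun X _ => ?_)
  congr

end Limits

/-! ### The determinant as a universal polynomial, and correlation functions -/

section Final

variable {N k : ℕ}

theorem card_setF {i : Fin k → Fin N} (hi : Function.Injective i) (a : Fin k → ℕ) :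
    (setF i a).card = ∑ p, (a p + 1) := by
  have h : ∀ p, setB (i p) (a p) ∪ setC (i p) (a p) = range (a p + 1) ×ˢ {i p} := fun p => by
    rw [setB, setC, ← Finset.union_product, Finset.union_comm, ← Finset.insert_eq,
      Finset.range_add_one]
  rw [setF, Finset.card_biUnion]
  · exact Finset.sum_congr rfl fun p _ => by
      rw [h, Finset.card_product, Finset.card_range, Finset.card_singleton, mul_one]
  · intro p _ q _ hpq
    change Disjoint (setB (i p) (a p) ∪ setC (i p) (a p)) (setB (i q) (a q) ∪ setC (i q) (a q))
    rw [h, h, Finset.disjoint_product]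
    exact Or.inr (by simpa using fun h => hpq (hi h))

/-- The matrix `blockMatrix` with indeterminates in place of the entries of the kernel. -/
def genericBlockMatrix (i : Fin k → Fin N) (a : Fin k → ℕ) :
    Matrix (setF i a) (setF i a)
      (MvPolynomial (setF i a × setF i a) (MvPolynomial (Fin k ⊕ Fin k) ℤ)) :=
  Matrix.of fun u v =>
    (if u = v then 1 else 0)
      - ∑ p : Fin k, MvPolynomial.C (1 - varZ ℤ p) *
          (if v.1 ∈ setB (i p) (a p) then MvPolynomial.X (u, v) else 0)
      - ∑ p : Fin k, MvPolynomial.C (1 - varW ℤ p) *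
          (if v.1 ∈ setC (i p) (a p) then MvPolynomial.X (u, v) else 0)

theorem det_blockMatrix_eq_eval₂ (i : Fin k → Fin N) (a : Fin k → ℕ)
    (K : Point N → Point N → ℂ) :
    (blockMatrix K i a).det =
      MvPolynomial.eval₂ (MvPolynomial.map (Int.castRingHom ℂ))
        (fun e => MvPolynomial.C (K e.1.1 e.2.1)) (genericBlockMatrix i a).det := by
  rw [← MvPolynomial.coe_eval₂Hom, RingHom.map_det]
  congr 1
  refine Matrix.ext fun u v => ?_
  rw [RingHom.mapMatrix_apply, Matrix.map_apply, blockMatrix, genericBlockMatrix, Matrix.of_apply,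
    Matrix.of_apply]
  simp only [map_sub, map_sum, map_mul, map_one, MvPolynomial.eval₂Hom_C, apply_ite
    (MvPolynomial.eval₂Hom (MvPolynomial.map (Int.castRingHom ℂ))
      (fun e : setF i a × setF i a => MvPolynomial.C (K e.1.1 e.2.1))), map_zero,
    MvPolynomial.eval₂Hom_X', varZ, varW, MvPolynomial.map_X]

theorem strictAnti_decreasing {a : Fin k → ℕ} (ha : Function.Injective a) :
    StrictAnti (decreasing a) := strictAnti_sort_rev ha

theorem range_decreasing (a : Fin k → ℕ) : Set.range (decreasing a) = Set.range a :=
  (Fin.revPerm.trans (Tuple.sort a)).surjective.range_comp a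

theorem range_eq_iff_eq_decreasing {a : Fin k → ℕ} (ha : Function.Injective a)
    {i : Fin k → Fin N} (hi : StrictMono i) (X : Config N) :
    Set.range (fun p => X.1 (i p)) = Set.range a ↔ ∀ p, X.1 (i p) = decreasing a p := by
  rw [← range_decreasing a]
  refine ⟨fun h => congrFun (strictAnti_eq_of_range_eq (fun p q hpq => X.2 (hi hpq))
    (strictAnti_decreasing ha) h), fun h => ?_⟩
  rw [show (fun p => X.1 (i p)) = decreasing a from funext h]

/-- A configuration contains all the given points if and only if these are its points at some
increasing indices, which are then unique. -/
theorem existsUnique_indices {a : Fin k → ℕ} (ha : Function.Injective a) (X : Config N)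
    (hX : ∀ p, a p ∈ Set.range X.1) :
    ∃! i : Fin k → Fin N, StrictMono i ∧ ∀ p, X.1 (i p) = decreasing a p := by
  choose i hi using fun p : Fin k => hX (Tuple.sort a p.rev)
  refine ⟨i, ⟨fun p q hpq => ?_, hi⟩, fun i' hi' => funext fun p => ?_⟩
  · have := strictAnti_decreasing ha hpq
    have h : ∀ p, X.1 (i p) = decreasing a p := hi
    rw [← h p, ← h q] at this
    exact X.2.lt_iff_gt.1 this
  · exact X.2.injective ((hi'.2 p).trans (hi p).symm)

open Classical in
theorem prob_contains_eq_sum {Φ Ψ : Fin N → ℕ → ℂ} {β : ℕ → ℂ} (hZ : normConst Φ Ψ β ≠ 0)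
    {a : Fin k → ℕ} (ha : Function.Injective a) :
    prob Φ Ψ β {X | ∀ p, a p ∈ Set.range X.1} =
      ∑ i : Fin k → Fin N with StrictMono i,
        prob Φ Ψ β {X | Set.range (fun p => X.1 (i p)) = Set.range a} := by
  simp only [prob_eq_tsum_div]
  rw [← Finset.sum_div, ← Summable.tsum_finsetSum fun i _ => summable_ite_weight hZ _]
  congr 1
  refine tsum_congr fun X => ?_
  split_ifs with hX
  · obtain ⟨i, ⟨hi, hiX⟩, huniq⟩ := existsUnique_indices ha X hX
    rw [Finset.sum_eq_single_of_mem i (by simpa using hi),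
      if_pos ((range_eq_iff_eq_decreasing ha hi X).2 hiX)]
    intro j hj hne
    refine if_neg fun h => hne ?_
    have hj' : StrictMono j := by simpa using hj
    exact huniq j ⟨hj', (range_eq_iff_eq_decreasing ha hj' X).1 h⟩
  · refine (Finset.sum_eq_zero fun j _ => if_neg fun h => hX fun p => ?_).symm
    have : a p ∈ Set.range fun p => X.1 (j p) := h ▸ Set.mem_range_self p
    obtain ⟨q, hq⟩ := this
    exact ⟨j q, hq⟩

end Final

end TiltedEnsemble

end

open Classical in
theorem proposition2p5 (N : ℕ) (hN : 1 ≤ N) (Φ Ψ : Fin N → ℕ → ℂ) (β : ℕ → ℂ)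
    (hconv : TiltedEnsemble.ConvolutionsConverge Φ Ψ β)
    (hZ : TiltedEnsemble.normConst Φ Ψ β ≠ 0) :
    -- marginal distributions
    (∀ (k : ℕ) (_ : 1 ≤ k) (i : Fin k → Fin N) (_ : StrictMono i)
        (a : Fin k → ℕ) (_ : StrictAnti a),
      TiltedEnsemble.prob Φ Ψ β {X | ∀ p, X.1 (i p) = a p} =
          TiltedEnsemble.detCoeff (TiltedEnsemble.kernel Φ Ψ β) i a ∧
      -- the size of the matrix
      (TiltedEnsemble.setF i a).card = ∑ p, (a p + 1) ∧
      -- the determinant is a universal polynomial in the entries of the kernel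
      ∃ P : MvPolynomial (TiltedEnsemble.setF i a × TiltedEnsemble.setF i a)
          (MvPolynomial (Fin k ⊕ Fin k) ℤ),
        ∀ K : TiltedEnsemble.Point N → TiltedEnsemble.Point N → ℂ,
          (TiltedEnsemble.blockMatrix K i a).det =
            MvPolynomial.eval₂ (MvPolynomial.map (Int.castRingHom ℂ))
              (fun e => MvPolynomial.C (K e.1.1 e.2.1)) P) ∧
    -- correlation functions
    (∀ (k : ℕ) (_ : 1 ≤ k) (a : Fin k → ℕ) (_ : Function.Injective a),
      TiltedEnsemble.prob Φ Ψ β {X | ∀ p, a p ∈ Set.range X.1} =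
          ∑ i : Fin k → Fin N with StrictMono i,
            TiltedEnsemble.prob Φ Ψ β {X | Set.range (fun p => X.1 (i p)) = Set.range a} ∧
      ∀ i : Fin k → Fin N, StrictMono i →
        TiltedEnsemble.prob Φ Ψ β {X | Set.range (fun p => X.1 (i p)) = Set.range a} =
          TiltedEnsemble.detCoeff (TiltedEnsemble.kernel Φ Ψ β) i
            (TiltedEnsemble.decreasing a)) := by
  refine ⟨fun k _ i hi a _ => ⟨TiltedEnsemble.prob_eq_detCoeff hN hconv hZ hi a,
    TiltedEnsemble.card_setF hi.injective a, (TiltedEnsemble.genericBlockMatrix i a).det,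
    TiltedEnsemble.det_blockMatrix_eq_eval₂ i a⟩,
    fun k _ a ha => ⟨TiltedEnsemble.prob_contains_eq_sum hZ ha, fun i hi => ?_⟩⟩
  rw [← TiltedEnsemble.prob_eq_detCoeff hN hconv hZ hi]
  congr 1
  ext X
  exact TiltedEnsemble.range_eq_iff_eq_decreasing ha hi X
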